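/- There are absolute constants $c_0, C_0, C_1 > 0$ such that the following holds for all integers $n, d \ge 1$, all $\boldsymbol{G}_1,\dots,\boldsymbol{G}_n \in \mathrm{O}(d) := \{\boldsymbol{O}\in\mathbb{R}^{d\times d} : \boldsymbol{O}\boldsymbol{O}^\top = \boldsymbol{O}^\top\boldsymbol{O} = \boldsymbol{I}_d\}$ and all real $\sigma \ge 0$ with $$\sigma < \frac{c_0\sqrt{n}}{\sqrt{d}\,(\sqrt{d}+\sqrt{\log n})}.$$ Let $\boldsymbol{G}^\top = [\boldsymbol{G}_1^\top,\dots,\boldsymbol{G}_n^\top] \in \mathbb{R}^{d\times nd}$ and $\boldsymbol{A} = \boldsymbol{G}\boldsymbol{G}^\top + \sigma\boldsymbol{W} \in \mathbb{R}^{nd\times nd}$, where $\boldsymbol{W}$ is a symmetric Gaussian random matrix: its entries on and above the diagonal are independent standard normal random variables. Write $\boldsymbol{X}_{ij}$ for the $(i,j)$-th $d\times d$ block of an $nd\times nd$ matrix $\boldsymbol{X}$ and $\langle \boldsymbol{X},\boldsymbol{Y}\rangle = \mathrm{Tr}(\boldsymbol{X}^\top\boldsymbol{Y})$. A maximum likelihood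 estimator (MLE) is a global maximizer $\widehat{\boldsymbol{G}} = (\widehat{\boldsymbol{G}}_1,\dots,\widehat{\boldsymbol{G}}_n)$ of $$\max_{\boldsymbol{R}_1,\dots,\boldsymbol{R}_n\in \mathrm{O}(d)}\ \sum_{i<j}\langle \boldsymbol{R}_i\boldsymbol{R}_j^\top, \boldsymbol{A}_{ij}\rangle .$$ Then, with probability at least $1 - C_1 n^{-2}$, the following statements hold together. (a) The semidefinite relaxation $$\max\ \langle \boldsymbol{A},\boldsymbol{X}\rangle \quad\text{such that}\quad \boldsymbol{X}\in\mathbb{R}^{nd\times nd},\ \boldsymbol{X}\succeq 0,\ \boldsymbol{X}_{ii} = \boldsymbol{I}_d \ (1\le i\le n)$$ is tight: it has exactly one solution $\boldsymbol{X}$; this solution has rank $d$; and it equals the MLE, that is, an MLE exists, and the MLEs are exactly those $\boldsymbol{R}\in\mathrm{O}(d)^n$ (stacked as an $nd\times d$ matrix) with $\boldsymbol{R}\boldsymbol{R}^\top = \boldsymbol{X}$. (b) Every MLE $\widehat{\boldsymbol{G}}$ satisfies $$\min_{\boldsymbol{Q}\in\mathrm{O}(d)}\max_{1\le i\le n}\|\widehat{\boldsymbol{G}}_i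 - \boldsymbol{G}_i\boldsymbol{Q}\|_F \le C_0\,\sigma\sqrt{n^{-1}d}\,(\sqrt{d}+\sqrt{\log n}).$$ -/

import Mathlib

open MeasureTheory ProbabilityTheory
open scoped Matrix Matrix.Norms.Frobenius

/-! Orthogonal group synchronization. A matrix of size `nd × nd` is indexed by `Fin n × Fin d`,
the first component being the block. The norm on matrices is the Frobenius norm. -/

namespace OrthSync

/-- The real matrices of size `nd × nd`, seen as `n × n` blocks of size `d × d`. -/
abbrev BigMatrix (n d : ℕ) := Matrix (Fin n × Fin d) (Fin n × Fin d) ℝ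

/-- The `(i, j)` block, of size `d × d`. -/
def block {n d : ℕ} (A : BigMatrix n d) (i j : Fin n) : Matrix (Fin d) (Fin d) ℝ :=
  Matrix.of fun a b => A (i, a) (j, b)

/-- `R Rᵀ` for the `nd × d` matrix `R` with blocks `R i`. Its `(i, j)` block is `R i * (R j)ᵀ`. -/
def gram {n d : ℕ} (R : Fin n → Matrix (Fin d) (Fin d) ℝ) : BigMatrix n d :=
  Matrix.of fun p q => (R p.1 * (R q.1)ᵀ) p.2 q.2

/-- The inner product `⟨X, Y⟩ = Tr (Xᵀ Y)` of two matrices of the same size. -/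
def matInner {m : Type*} [Fintype m] (X Y : Matrix m m ℝ) : ℝ := (Xᵀ * Y).trace

/-- `W` is a symmetric Gaussian random matrix: every entry is standard normal and the entries on
and above the diagonal are independent. The order of the rows and columns is lexicographic. -/
structure IsSymmGaussian {Ω : Type*} [MeasurableSpace Ω] {n d : ℕ}
    (W : Ω → BigMatrix n d) (P : Measure Ω) : Prop where
  symm : ∀ ω, (W ω).IsSymm
  law : ∀ p q, HasLaw (fun ω => W ω p q) (gaussianReal 0 1) P
  indep : iIndepFun
    (fun (e : {e : (Fin n × Fin d) × (Fin n × Fin d) // toLex e.1 ≤ toLex e.2}) ω =>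
      W ω e.1.1 e.1.2) P

/-- The data `A = G Gᵀ + σ W`. -/
def observation {n d : ℕ} (G : Fin n → Matrix (Fin d) (Fin d) ℝ) (σ : ℝ) (W : BigMatrix n d) :
    BigMatrix n d :=
  gram G + σ • W

/-- All blocks are orthogonal, i.e. `R ∈ O(d)^n`. -/
def IsOrth {n d : ℕ} (R : Fin n → Matrix (Fin d) (Fin d) ℝ) : Prop :=
  ∀ i, R i ∈ Matrix.orthogonalGroup (Fin d) ℝ

/-- The objective `∑_{i < j} ⟨R_i R_jᵀ, A_ij⟩` of the maximum likelihood problem. -/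
def mleObjective {n d : ℕ} (A : BigMatrix n d) (R : Fin n → Matrix (Fin d) (Fin d) ℝ) : ℝ :=
  ∑ i, ∑ j ∈ Finset.Ioi i, matInner (R i * (R j)ᵀ) (block A i j)

/-- `R` is a maximum likelihood estimator: a global maximizer of the objective over `O(d)^n`. -/
def IsMLE {n d : ℕ} (A : BigMatrix n d) (R : Fin n → Matrix (Fin d) (Fin d) ℝ) : Prop :=
  IsOrth R ∧ ∀ R', IsOrth R' → mleObjective A R' ≤ mleObjective A R

/-- Feasible points of the semidefinite relaxation: `X ⪰ 0` and `X_ii = I_d`. -/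
def IsFeasible {n d : ℕ} (X : BigMatrix n d) : Prop :=
  X.PosSemidef ∧ ∀ i, block X i i = 1

/-- `X` is a solution (global maximizer) of `max ⟨A, X⟩` subject to `X ⪰ 0` and `X_ii = I_d`. -/
def IsSDPSolution {n d : ℕ} (A X : BigMatrix n d) : Prop :=
  IsFeasible X ∧ ∀ Y, IsFeasible Y → matInner A Y ≤ matInner A X

/-- Tightness: the relaxation has exactly one solution `X`, its rank is `d`, and it equals the
maximum likelihood estimator: the maximum likelihood estimators exist and are exactly the
`R ∈ O(d)^n` with `R Rᵀ = X` (so they form one orbit of the global action of `O(d)`). -/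
def IsTight {n d : ℕ} (A : BigMatrix n d) : Prop :=
  ∃ X, IsSDPSolution A X ∧ (∀ Y, IsSDPSolution A Y → Y = X) ∧ X.rank = d ∧
    (∃ R, IsMLE A R) ∧ ∀ R, IsMLE A R ↔ IsOrth R ∧ gram R = X

/-- `min_{Q ∈ O(d)} max_i ‖R_i - G_i Q‖_F ≤ b`. -/
def BlockErrorLE {n d : ℕ} (R G : Fin n → Matrix (Fin d) (Fin d) ℝ) (b : ℝ) : Prop :=
  ∃ Q ∈ Matrix.orthogonalGroup (Fin d) ℝ, ∀ i, ‖R i - G i * Q‖ ≤ b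

end OrthSync

/-! Write `N = σ W`. The power iteration for `G Gᵀ + N` replaces `R` by the blockwise polar factors
of `G (Gᵀ R) + N R`. Two changes make it a contraction near `G`, for every `N` with
`‖N‖_op √d ≤ n / 16`: `Gᵀ R` is replaced by its symmetric part, which removes the freedom of a
global rotation, and the blocks of `N R` are clipped at norm `n / 8`. Its fixed point `R` depends on
`N` in a Lipschitz way.

The clipping turns out to be inactive with high probability. The fixed point `S` for the noise whose
`i`-th block row and column are zeroed is independent of the `i`-th block row of `N`, so the `i`-th
block of `N S` is as small as a Gaussian allows, and stability carries this bound over to `N R`.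
Without clipping, the symmetry of the polar factors and of `N` forces `Gᵀ R` to be symmetric.
Therefore `(G Gᵀ + N) R = Λ R` with a block diagonal `Λ ⪰ (3/4) n`, and `Λ - G Gᵀ - N` annihilates
`R` and is positive on the complement of its range: it is a dual certificate, from which tightness
and uniqueness follow. The error bound is the Lipschitz estimate for the polar factor. -/

namespace OrthSync

section Frobenius

variable {m n k : Type*} [Fintype m] [Fintype n] [Fintype k]

lemma frobenius_norm_sq_eq_sum (A : Matrix m n ℝ) : ‖A‖ ^ 2 = ∑ i, ∑ j, A i j ^ 2 := by
  rw [Matrix.frobenius_norm_def, ← Real.sqrt_eq_rpow, Real.sq_sqrt (by positivity)]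
  simp

lemma trace_transpose_mul_eq_sum (A B : Matrix m n ℝ) :
    (Aᵀ * B).trace = ∑ i, ∑ j, A i j * B i j := by
  simp only [Matrix.trace, Matrix.diag, Matrix.mul_apply, Matrix.transpose_apply]
  exact Finset.sum_comm

lemma frobenius_norm_sq_eq_trace (A : Matrix m n ℝ) : ‖A‖ ^ 2 = (Aᵀ * A).trace := by
  rw [frobenius_norm_sq_eq_sum, trace_transpose_mul_eq_sum]
  simp only [sq]

lemma frobenius_norm_sq_eq_sum_col (A : Matrix m n ℝ) : ‖A‖ ^ 2 = ∑ j, A.col j ⬝ᵥ A.col j := by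
  rw [frobenius_norm_sq_eq_sum, Finset.sum_comm]
  simp only [dotProduct, Matrix.col_apply, sq]

lemma trace_transpose_mul_le (A B : Matrix m n ℝ) : (Aᵀ * B).trace ≤ ‖A‖ * ‖B‖ := by
  refine le_of_sq_le_sq ?_ (by positivity)
  rw [trace_transpose_mul_eq_sum, mul_pow, frobenius_norm_sq_eq_sum, frobenius_norm_sq_eq_sum]
  simp only [← Finset.sum_product']
  exact Finset.sum_mul_sq_le_sq_mul_sq _ _ _

lemma trace_mul_transpose_le (A B : Matrix m n ℝ) : (A * Bᵀ).trace ≤ ‖A‖ * ‖B‖ := by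
  rw [Matrix.trace_mul_comm, mul_comm ‖A‖]
  exact trace_transpose_mul_le B A

lemma frobenius_norm_sq_mul [DecidableEq n] {c : ℝ} {U : Matrix m n ℝ} (hU : Uᵀ * U = c • 1)
    (A : Matrix n k ℝ) : ‖U * A‖ ^ 2 = c * ‖A‖ ^ 2 := by
  rw [frobenius_norm_sq_eq_trace, frobenius_norm_sq_eq_trace, Matrix.transpose_mul,
    Matrix.mul_assoc, ← Matrix.mul_assoc Uᵀ, hU, Matrix.smul_mul, Matrix.one_mul, Matrix.mul_smul,
    Matrix.trace_smul, smul_eq_mul]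

lemma frobenius_norm_sq_of_transpose_mul_self [DecidableEq n] {U : Matrix m n ℝ} {c : ℝ}
    (hU : Uᵀ * U = c • 1) : ‖U‖ ^ 2 = c * Fintype.card n := by
  rw [frobenius_norm_sq_eq_trace, hU, Matrix.trace_smul, Matrix.trace_one, smul_eq_mul]

lemma frobenius_norm_sq_mul_le [DecidableEq n] {c : ℝ} (hc : 0 ≤ c) {U : Matrix m n ℝ}
    (hU : Uᵀ * U = c • 1) (A : Matrix k m ℝ) : ‖A * U‖ ^ 2 ≤ c * ‖A‖ ^ 2 := by
  have hdual : ‖A * U‖ ^ 2 ≤ ‖A‖ * ‖U * (A * U)ᵀ‖ := by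
    calc ‖A * U‖ ^ 2 = (A * (U * (A * U)ᵀ)).trace := by
          rw [frobenius_norm_sq_eq_trace, Matrix.trace_mul_comm, Matrix.mul_assoc]
      _ ≤ ‖A‖ * ‖(U * (A * U)ᵀ)ᵀ‖ := by
          simpa only [Matrix.transpose_transpose] using trace_mul_transpose_le A (U * (A * U)ᵀ)ᵀ
      _ = ‖A‖ * ‖U * (A * U)ᵀ‖ := by rw [Matrix.frobenius_norm_transpose]
  have hsq : (‖A * U‖ ^ 2) ^ 2 ≤ c * ‖A‖ ^ 2 * ‖A * U‖ ^ 2 := by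
    refine (pow_le_pow_left₀ (sq_nonneg _) hdual 2).trans_eq ?_
    rw [mul_pow, frobenius_norm_sq_mul hU, Matrix.frobenius_norm_transpose]
    ring
  rcases (sq_nonneg ‖A * U‖).eq_or_lt' with h0 | hpos
  · rw [h0]
    positivity
  · exact le_of_mul_le_mul_right ((sq _).symm.trans_le hsq) hpos

lemma measurable_frobenius_norm {X : Type*} [MeasurableSpace X] {A : X → Matrix m n ℝ}
    (hA : ∀ i j, Measurable fun x => A x i j) :
    Measurable fun x => ‖A x‖ := by
  simp only [Matrix.frobenius_norm_def]
  fun_prop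

end Frobenius

section OpNorm

lemma norm_toLp_sq {m : Type*} [Fintype m] (x : m → ℝ) : ‖WithLp.toLp 2 x‖ ^ 2 = x ⬝ᵥ x := by
  rw [EuclideanSpace.real_norm_sq_eq]
  simp only [dotProduct, sq]

variable {m k : Type*} [Fintype m] [DecidableEq m] [Fintype k]

/-- The operator norm of a square matrix with respect to the Euclidean norm; `‖·‖` is reserved for
the Frobenius norm. -/
noncomputable def opNorm (N : Matrix m m ℝ) : ℝ := ‖Matrix.toEuclideanCLM (𝕜 := ℝ) N‖

lemma opNorm_nonneg (N : Matrix m m ℝ) : 0 ≤ opNorm N := norm_nonneg _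

lemma opNorm_smul (c : ℝ) (N : Matrix m m ℝ) : opNorm (c • N) = |c| * opNorm N := by
  rw [opNorm, map_smul, norm_smul, Real.norm_eq_abs, opNorm]

lemma opNorm_mul_le (M N : Matrix m m ℝ) : opNorm (M * N) ≤ opNorm M * opNorm N := by
  simpa only [opNorm, map_mul] using norm_mul_le _ _

lemma continuous_opNorm : Continuous (opNorm : Matrix m m ℝ → ℝ) :=
  (LinearMap.continuous_of_finiteDimensional
    (Matrix.toEuclideanCLM (n := m) (𝕜 := ℝ)).toAlgEquiv.toLinearMap).norm

lemma norm_toLp_mulVec_le (N : Matrix m m ℝ) (x : m → ℝ) :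
    ‖WithLp.toLp 2 (N *ᵥ x)‖ ≤ opNorm N * ‖WithLp.toLp 2 x‖ :=
  (Matrix.toEuclideanCLM (𝕜 := ℝ) N).le_opNorm (WithLp.toLp 2 x)

lemma mulVec_dotProduct_self_le (N : Matrix m m ℝ) (x : m → ℝ) :
    (N *ᵥ x) ⬝ᵥ (N *ᵥ x) ≤ opNorm N ^ 2 * (x ⬝ᵥ x) := by
  rw [← norm_toLp_sq, ← norm_toLp_sq, ← mul_pow]
  exact pow_le_pow_left₀ (norm_nonneg _) (norm_toLp_mulVec_le N x) 2

lemma dotProduct_mulVec_le_opNorm (N : Matrix m m ℝ) (x : m → ℝ) :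
    x ⬝ᵥ (N *ᵥ x) ≤ opNorm N * (x ⬝ᵥ x) := by
  calc x ⬝ᵥ (N *ᵥ x)
      = inner ℝ (WithLp.toLp 2 (N *ᵥ x)) (WithLp.toLp 2 x) := by
        simp [PiLp.inner_apply, dotProduct]
    _ ≤ ‖WithLp.toLp 2 (N *ᵥ x)‖ * ‖WithLp.toLp 2 x‖ := real_inner_le_norm _ _
    _ ≤ opNorm N * ‖WithLp.toLp 2 x‖ * ‖WithLp.toLp 2 x‖ := by
        gcongr; exact norm_toLp_mulVec_le N x
    _ = opNorm N * (x ⬝ᵥ x) := by rw [mul_assoc, ← sq, norm_toLp_sq]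

lemma norm_mul_le_opNorm_mul (N : Matrix m m ℝ) (X : Matrix m k ℝ) :
    ‖N * X‖ ≤ opNorm N * ‖X‖ := by
  refine le_of_sq_le_sq ?_ (mul_nonneg (opNorm_nonneg N) (norm_nonneg X))
  rw [mul_pow, frobenius_norm_sq_eq_sum_col, frobenius_norm_sq_eq_sum_col, Finset.mul_sum]
  exact Finset.sum_le_sum fun j _ => mulVec_dotProduct_self_le N (X.col j)

lemma opNorm_le_norm (N : Matrix m m ℝ) : opNorm N ≤ ‖N‖ := by
  refine ContinuousLinearMap.opNorm_le_bound _ (norm_nonneg N) fun x => ?_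
  refine le_of_sq_le_sq ?_ (by positivity)
  rw [mul_pow, frobenius_norm_sq_eq_sum, Finset.sum_mul, EuclideanSpace.real_norm_sq_eq,
    EuclideanSpace.real_norm_sq_eq]
  exact Finset.sum_le_sum fun i _ => Finset.sum_mul_sq_le_sq_mul_sq _ _ _

lemma opNorm_diagonal (v : m → ℝ) : opNorm (Matrix.diagonal v) = ‖v‖ :=
  Matrix.l2_opNorm_diagonal v

end OpNorm

section Polar

variable {k : Type*} [Fintype k] [DecidableEq k]

lemma mul_transpose_of_mem_orthogonalGroup {U : Matrix k k ℝ}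
    (hU : U ∈ Matrix.orthogonalGroup k ℝ) : U * Uᵀ = 1 :=
  (Matrix.mem_orthogonalGroup_iff k ℝ).1 hU

lemma transpose_mul_of_mem_orthogonalGroup {U : Matrix k k ℝ}
    (hU : U ∈ Matrix.orthogonalGroup k ℝ) : Uᵀ * U = 1 :=
  (Matrix.mem_orthogonalGroup_iff' k ℝ).1 hU

/-- `U` is an orthogonal polar factor of `M = Λ U`, where `Λ` is symmetric and `Λ ⪰ ℓ I`. -/
def IsPolar (ℓ : ℝ) (M U : Matrix k k ℝ) : Prop :=
  U ∈ Matrix.orthogonalGroup k ℝ ∧ (M * Uᵀ - ℓ • (1 : Matrix k k ℝ)).PosSemidef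

lemma IsPolar.transpose_mul_transpose {ℓ : ℝ} {M U : Matrix k k ℝ} (h : IsPolar ℓ M U) :
    (M * Uᵀ)ᵀ = M * Uᵀ := by
  have hsymm := h.2.isHermitian
  rw [Matrix.IsHermitian, Matrix.conjTranspose_eq_transpose_of_trivial, Matrix.transpose_sub,
    Matrix.transpose_smul, Matrix.transpose_one] at hsymm
  exact sub_left_injective hsymm

lemma IsPolar.trace_conj_eq {ℓ : ℝ} {M U V : Matrix k k ℝ} (h : IsPolar ℓ M U)
    (hV : V ∈ Matrix.orthogonalGroup k ℝ) :
    ((U - V)ᵀ * (M * Uᵀ) * (U - V)).trace = 2 * (M * (U - V)ᵀ).trace := by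
  have hM : M * Uᵀ * U = M := by
    rw [Matrix.mul_assoc, transpose_mul_of_mem_orthogonalGroup h.1, Matrix.mul_one]
  have hcross : (M * Uᵀ * (V * Uᵀ)).trace = (M * Vᵀ).trace := by
    rw [← Matrix.trace_transpose, Matrix.transpose_mul, h.transpose_mul_transpose,
      Matrix.transpose_mul, Matrix.transpose_transpose, Matrix.trace_mul_comm, ← Matrix.mul_assoc,
      hM]
  calc ((U - V)ᵀ * (M * Uᵀ) * (U - V)).trace
      = (M * Uᵀ * ((U - V) * (U - V)ᵀ)).trace := by
        rw [Matrix.trace_mul_comm, ← Matrix.mul_assoc, Matrix.trace_mul_comm]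
    _ = (M * Uᵀ * (1 + 1 - V * Uᵀ - U * Vᵀ)).trace := by
        rw [Matrix.transpose_sub, Matrix.sub_mul, Matrix.mul_sub U, Matrix.mul_sub V,
          mul_transpose_of_mem_orthogonalGroup h.1, mul_transpose_of_mem_orthogonalGroup hV]
        congr 2
        abel
    _ = 2 * (M * (U - V)ᵀ).trace := by
        rw [Matrix.mul_sub, Matrix.mul_sub, Matrix.mul_add, Matrix.mul_one, Matrix.trace_sub,
          Matrix.trace_sub, Matrix.trace_add, hcross, ← Matrix.mul_assoc, hM, Matrix.transpose_sub,
          Matrix.mul_sub, Matrix.trace_sub]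
        ring

lemma IsPolar.half_mul_norm_sub_sq_le_trace {ℓ : ℝ} {M U V : Matrix k k ℝ} (h : IsPolar ℓ M U)
    (hV : V ∈ Matrix.orthogonalGroup k ℝ) :
    ℓ / 2 * ‖U - V‖ ^ 2 ≤ (M * (U - V)ᵀ).trace := by
  have hconj := (h.2.conjTranspose_mul_mul_same (U - V)).trace_nonneg
  rw [Matrix.conjTranspose_eq_transpose_of_trivial, Matrix.mul_sub (U - V)ᵀ,
    Matrix.sub_mul _ _ (U - V), Matrix.trace_sub, h.trace_conj_eq hV, Matrix.mul_smul,
    Matrix.mul_one, Matrix.smul_mul, Matrix.trace_smul, ← frobenius_norm_sq_eq_trace,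
    smul_eq_mul] at hconj
  linarith

lemma IsPolar.mul_norm_sub_le {ℓ : ℝ} {M M' U U' : Matrix k k ℝ} (h : IsPolar ℓ M U)
    (h' : IsPolar ℓ M' U') : ℓ * ‖U - U'‖ ≤ ‖M - M'‖ := by
  rcases (norm_nonneg (U - U')).eq_or_lt with h0 | h0
  · simp [← h0]
  have hU := h.half_mul_norm_sub_sq_le_trace h'.1
  have hU' := h'.half_mul_norm_sub_sq_le_trace h.1
  rw [norm_sub_rev, ← neg_sub U U', Matrix.transpose_neg, Matrix.mul_neg, Matrix.trace_neg] at hU'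
  have hcs := trace_mul_transpose_le (M - M') (U - U')
  rw [Matrix.sub_mul, Matrix.trace_sub] at hcs
  exact le_of_mul_le_mul_right (by linarith) h0

lemma isPolar_smul_self {ℓ c : ℝ} (h : ℓ ≤ c) {G : Matrix k k ℝ}
    (hG : G ∈ Matrix.orthogonalGroup k ℝ) : IsPolar ℓ (c • G) G := by
  refine ⟨hG, ?_⟩
  rw [Matrix.smul_mul, mul_transpose_of_mem_orthogonalGroup hG, ← sub_smul]
  exact Matrix.PosSemidef.one.smul (sub_nonneg.2 h)

open scoped MatrixOrder in
lemma smul_one_le_sqrt {ℓ : ℝ} {A : Matrix k k ℝ} (hA : (ℓ ^ 2) • 1 ≤ A) :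
    ℓ • 1 ≤ CFC.sqrt A := by
  have hA0 : 0 ≤ A := le_trans (smul_nonneg (sq_nonneg ℓ) zero_le_one) hA
  rw [← Algebra.algebraMap_eq_smul_one] at hA ⊢
  rw [CFC.sqrt_eq_real_sqrt A hA0, cfcₙ_eq_cfc]
  rw [algebraMap_le_iff_le_spectrum] at hA
  refine (algebraMap_le_cfc_iff Real.sqrt ℓ A).2 fun x hx => Real.le_sqrt_of_sq_le (hA x hx)

open scoped MatrixOrder in
lemma exists_isPolar {ℓ : ℝ} (hℓ : 0 < ℓ) {M : Matrix k k ℝ} (hM : (ℓ ^ 2) • 1 ≤ M * Mᵀ) :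
    ∃ U, IsPolar ℓ M U := by
  set P := CFC.sqrt (M * Mᵀ)
  have hPP : P * P = M * Mᵀ :=
    CFC.sqrt_mul_sqrt_self _ (le_trans (smul_nonneg (sq_nonneg ℓ) zero_le_one) hM)
  have hPℓ : (P - ℓ • (1 : Matrix k k ℝ)).PosSemidef := smul_one_le_sqrt hM
  have hPt : Pᵀ = P := (CFC.sqrt_nonneg (M * Mᵀ)).isSelfAdjoint
  have hdet : IsUnit P.det := by
    have hpd : P.PosDef := by simpa using (Matrix.PosDef.one.smul hℓ).add_posSemidef hPℓ
    exact hpd.isUnit.map Matrix.detMonoidHom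
  have hMU : M * (P⁻¹ * M)ᵀ = P := by
    rw [Matrix.transpose_mul, Matrix.transpose_nonsing_inv, hPt, ← Matrix.mul_assoc, ← hPP,
      Matrix.mul_assoc, Matrix.mul_nonsing_inv _ hdet, Matrix.mul_one]
  refine ⟨P⁻¹ * M, ?_, by rwa [hMU]⟩
  refine (Matrix.mem_orthogonalGroup_iff k ℝ).2 ?_
  change P⁻¹ * M * (P⁻¹ * M)ᵀ = 1
  rw [Matrix.mul_assoc, hMU, Matrix.nonsing_inv_mul _ hdet]

open scoped MatrixOrder in
lemma exists_isPolar_of_norm_sub_le {ℓ c : ℝ} (hℓ : 0 < ℓ) {M G : Matrix k k ℝ}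
    (hG : G ∈ Matrix.orthogonalGroup k ℝ) (h : ‖M - c • G‖ ≤ c - ℓ) : ∃ U, IsPolar ℓ M U := by
  refine exists_isPolar hℓ <| Matrix.PosSemidef.of_dotProduct_mulVec_nonneg ?_ fun x => ?_
  · simp [Matrix.IsHermitian, Matrix.conjTranspose_eq_transpose_of_trivial]
  have hc : 0 ≤ c := by linarith [norm_nonneg (M - c • G)]
  have hGx : ‖WithLp.toLp 2 (Gᵀ *ᵥ x)‖ = ‖WithLp.toLp 2 x‖ := by
    rw [← sq_eq_sq₀ (norm_nonneg _) (norm_nonneg _), norm_toLp_sq, norm_toLp_sq,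
      Matrix.dotProduct_mulVec, Matrix.vecMul_transpose, Matrix.mulVec_mulVec,
      mul_transpose_of_mem_orthogonalGroup hG, Matrix.one_mulVec]
  have herr : ‖WithLp.toLp 2 ((c • G - M)ᵀ *ᵥ x)‖ ≤ (c - ℓ) * ‖WithLp.toLp 2 x‖ := by
    refine (norm_toLp_mulVec_le _ x).trans (mul_le_mul_of_nonneg_right ?_ (norm_nonneg _))
    refine (opNorm_le_norm _).trans ?_
    rwa [Matrix.frobenius_norm_transpose, norm_sub_rev]
  have hMx : ℓ * ‖WithLp.toLp 2 x‖ ≤ ‖WithLp.toLp 2 (Mᵀ *ᵥ x)‖ := by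
    have hsum : WithLp.toLp 2 (Mᵀ *ᵥ x) + WithLp.toLp 2 ((c • G - M)ᵀ *ᵥ x)
        = c • WithLp.toLp 2 (Gᵀ *ᵥ x) := by
      rw [← WithLp.toLp_add, ← Matrix.add_mulVec, ← WithLp.toLp_smul, ← Matrix.smul_mulVec]
      simp
    have htri := norm_add_le (WithLp.toLp 2 (Mᵀ *ᵥ x)) (WithLp.toLp 2 ((c • G - M)ᵀ *ᵥ x))
    rw [hsum, norm_smul, hGx, Real.norm_of_nonneg hc] at htri
    linarith
  have hsq := pow_le_pow_left₀ (by positivity) hMx 2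
  rw [mul_pow, norm_toLp_sq, norm_toLp_sq, Matrix.dotProduct_mulVec, Matrix.vecMul_transpose,
    Matrix.mulVec_mulVec] at hsq
  rw [star_trivial, Matrix.sub_mulVec, dotProduct_sub, Matrix.smul_mulVec, Matrix.one_mulVec,
    dotProduct_smul, smul_eq_mul, sub_nonneg]
  rwa [dotProduct_comm x (_ *ᵥ _)]

end Polar

section Stack

variable {n d : ℕ}

/-- The real matrices of size `nd × d`, seen as stacks of `n` square blocks. -/
abbrev Stack (n d : ℕ) := Matrix (Fin n × Fin d) (Fin d) ℝ

/-- The `i`-th block of an `nd × d` matrix. -/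
def rowBlock (R : Stack n d) (i : Fin n) : Matrix (Fin d) (Fin d) ℝ :=
  Matrix.of fun a b => R (i, a) b

/-- The `nd × d` matrix with prescribed blocks, inverse to `rowBlock`. -/
def stack (R : Fin n → Matrix (Fin d) (Fin d) ℝ) : Stack n d :=
  Matrix.of fun p b => R p.1 p.2 b

lemma norm_sq_eq_sum_rowBlock (R : Stack n d) : ‖R‖ ^ 2 = ∑ i, ‖rowBlock R i‖ ^ 2 := by
  simp only [frobenius_norm_sq_eq_sum, Fintype.sum_prod_type]
  rfl

lemma norm_rowBlock_le (R : Stack n d) (i : Fin n) : ‖rowBlock R i‖ ≤ ‖R‖ := by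
  refine le_of_sq_le_sq ?_ (norm_nonneg _)
  rw [norm_sq_eq_sum_rowBlock R]
  exact Finset.single_le_sum (f := fun i => ‖rowBlock R i‖ ^ 2) (fun _ _ => sq_nonneg _)
    (Finset.mem_univ i)

lemma norm_le_of_rowBlock_le {R S : Stack n d} {c : ℝ} (hc : 0 ≤ c)
    (h : ∀ i, ‖rowBlock R i‖ ≤ c * ‖rowBlock S i‖) : ‖R‖ ≤ c * ‖S‖ := by
  refine le_of_sq_le_sq ?_ (by positivity)
  rw [mul_pow, norm_sq_eq_sum_rowBlock, norm_sq_eq_sum_rowBlock, Finset.mul_sum]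
  refine Finset.sum_le_sum fun i _ => ?_
  rw [← mul_pow]
  exact pow_le_pow_left₀ (norm_nonneg _) (h i) 2

lemma transpose_mul_eq_sum_rowBlock (R S : Stack n d) :
    Rᵀ * S = ∑ i, (rowBlock R i)ᵀ * rowBlock S i := by
  ext a b
  simp only [Matrix.mul_apply, Matrix.transpose_apply, Fintype.sum_prod_type, Matrix.sum_apply]
  rfl

lemma IsOrth.transpose_mul_self {R : Stack n d} (h : IsOrth (rowBlock R)) :
    Rᵀ * R = (n : ℝ) • 1 := by
  rw [transpose_mul_eq_sum_rowBlock,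
    Finset.sum_congr rfl fun i _ => transpose_mul_of_mem_orthogonalGroup (h i)]
  simp [← Nat.cast_smul_eq_nsmul ℝ]

lemma IsOrth.norm_eq {R : Stack n d} (h : IsOrth (rowBlock R)) : ‖R‖ = √n * √d := by
  rw [← Real.sqrt_mul (Nat.cast_nonneg n), ← Real.sqrt_sq (norm_nonneg R),
    frobenius_norm_sq_of_transpose_mul_self h.transpose_mul_self, Fintype.card_fin]

lemma IsOrth.norm_mul {R : Stack n d} (h : IsOrth (rowBlock R)) (X : Matrix (Fin d) (Fin d) ℝ) :
    ‖R * X‖ = √n * ‖X‖ := by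
  rw [← sq_eq_sq₀ (norm_nonneg _) (by positivity), mul_pow, Real.sq_sqrt (Nat.cast_nonneg n)]
  exact frobenius_norm_sq_mul h.transpose_mul_self X

lemma IsOrth.norm_rowBlock_mul {R : Stack n d} (h : IsOrth (rowBlock R))
    (X : Matrix (Fin d) (Fin d) ℝ) (i : Fin n) : ‖rowBlock R i * X‖ = ‖X‖ := by
  rw [← sq_eq_sq₀ (norm_nonneg _) (norm_nonneg _), frobenius_norm_sq_mul (c := 1), one_mul]
  rw [one_smul, transpose_mul_of_mem_orthogonalGroup (h i)]

lemma isClosed_isOrth : IsClosed {R : Stack n d | IsOrth (rowBlock R)} := by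
  have hset : {R : Stack n d | IsOrth (rowBlock R)}
      = ⋂ i, {R : Stack n d | rowBlock R i * (rowBlock R i)ᵀ = 1} := by
    ext R
    simp only [Set.mem_ofPred_eq, Set.mem_iInter]
    exact forall_congr' fun i => Matrix.mem_orthogonalGroup_iff _ ℝ
  have hcont (i : Fin n) : Continuous fun R : Stack n d => rowBlock R i := by
    unfold rowBlock
    fun_prop
  rw [hset]
  exact isClosed_iInter fun i =>
    isClosed_eq ((hcont i).matrix_mul (hcont i).matrix_transpose) continuous_const

lemma opNorm_le_of_mul_sqrt_le {N : BigMatrix n d} {c : ℝ} (h : opNorm N * √d ≤ c) :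
    opNorm N ≤ c := by
  rcases d.eq_zero_or_pos with rfl | hd
  · simpa [opNorm, Subsingleton.elim N 0] using h
  · refine le_trans (le_mul_of_one_le_right (opNorm_nonneg N) ?_) h
    exact Real.one_le_sqrt.2 (by exact_mod_cast hd)

end Stack

section Clip

variable {E : Type*} [NormedAddCommGroup E] [NormedSpace ℝ E] {r : ℝ}

/-- The radial projection onto the closed ball of radius `r` about the origin. -/
noncomputable def clip (r : ℝ) (x : E) : E := (r / max r ‖x‖) • x

lemma clip_of_norm_le (hr : 0 < r) {x : E} (h : ‖x‖ ≤ r) : clip r x = x := by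
  rw [clip, max_eq_left h, div_self hr.ne', one_smul]

lemma norm_clip_le (hr : 0 < r) (x : E) : ‖clip r x‖ ≤ r := by
  have hm : 0 < max r ‖x‖ := lt_max_of_lt_left hr
  rw [clip, norm_smul, Real.norm_of_nonneg (by positivity), div_mul_eq_mul_div, div_le_iff₀ hm]
  exact mul_le_mul_of_nonneg_left (le_max_right _ _) hr.le

lemma norm_div_max_smul_le (hr : 0 < r) (x y : E) : ‖(r / max r ‖x‖) • y‖ ≤ ‖y‖ := by
  have hm : 0 < max r ‖x‖ := lt_max_of_lt_left hr
  rw [norm_smul, Real.norm_of_nonneg (by positivity)]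
  exact mul_le_of_le_one_left (norm_nonneg _) ((div_le_one hm).2 (le_max_left _ _))

lemma norm_clip_sub_clip_le (hr : 0 < r) (x y : E) :
    ‖clip r x - clip r y‖ ≤ 2 * ‖x - y‖ := by
  have hx : 0 < max r ‖x‖ := lt_max_of_lt_left hr
  have hy : 0 < max r ‖y‖ := lt_max_of_lt_left hr
  have hdiff : clip r x - clip r y
      = (r / max r ‖x‖) • ((x - y) + ((max r ‖y‖ - max r ‖x‖) / max r ‖y‖) • y) := by
    simp only [clip, smul_add, smul_sub, smul_smul, sub_div, sub_smul]
    rw [div_self hy.ne', mul_one, div_mul_div_cancel₀ hx.ne']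
    abel
  have hmax : |max r ‖y‖ - max r ‖x‖| ≤ ‖x - y‖ := by
    rw [max_comm r, max_comm r, norm_sub_rev]
    exact (abs_max_sub_max_le_abs _ _ _).trans (abs_norm_sub_norm_le y x)
  have hrem : ‖((max r ‖y‖ - max r ‖x‖) / max r ‖y‖) • y‖ ≤ ‖x - y‖ := by
    rw [norm_smul, norm_div, Real.norm_eq_abs, Real.norm_of_nonneg hy.le, div_mul_eq_mul_div,
      div_le_iff₀ hy]
    exact mul_le_mul hmax (le_max_right _ _) (norm_nonneg _) (norm_nonneg _)
  rw [hdiff]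
  exact (norm_div_max_smul_le hr x _).trans ((norm_add_le _ _).trans (by linarith))

variable {n d : ℕ}

/-- The blockwise radial projection. -/
noncomputable def clipStack (r : ℝ) (Y : Stack n d) : Stack n d :=
  stack fun i => clip r (rowBlock Y i)

lemma norm_clipStack_le (hr : 0 < r) (Y : Stack n d) : ‖clipStack r Y‖ ≤ ‖Y‖ := by
  rw [← one_mul ‖Y‖]
  refine norm_le_of_rowBlock_le zero_le_one fun i => ?_
  rw [one_mul]
  exact norm_div_max_smul_le hr (rowBlock Y i) (rowBlock Y i)

lemma norm_clipStack_sub_le (hr : 0 < r) (Y Z : Stack n d) :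
    ‖clipStack r Y - clipStack r Z‖ ≤ 2 * ‖Y - Z‖ :=
  norm_le_of_rowBlock_le zero_le_two fun i =>
    norm_clip_sub_clip_le hr (rowBlock Y i) (rowBlock Z i)

end Clip

section Overlap

variable {n d : ℕ} {G R S : Stack n d}

/-- The symmetric part of `Gᵀ R`. -/
noncomputable def overlap (G R : Stack n d) : Matrix (Fin d) (Fin d) ℝ :=
  (1 / 2 : ℝ) • (Gᵀ * R + Rᵀ * G)

lemma overlap_eq (hG : IsOrth (rowBlock G)) (hR : IsOrth (rowBlock R)) :
    overlap G R = (n : ℝ) • 1 - (1 / 2 : ℝ) • ((R - G)ᵀ * (R - G)) := by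
  rw [overlap, Matrix.transpose_sub, Matrix.sub_mul, Matrix.mul_sub, Matrix.mul_sub,
    hG.transpose_mul_self, hR.transpose_mul_self]
  module

lemma norm_overlap_sub_le (hG : IsOrth (rowBlock G)) (hR : IsOrth (rowBlock R)) :
    ‖overlap G R - (n : ℝ) • 1‖ ≤ 1 / 2 * ‖R - G‖ ^ 2 := by
  rw [overlap_eq hG hR, sub_sub_cancel_left, norm_neg, norm_smul,
    Real.norm_of_nonneg (by norm_num), sq]
  gcongr
  simpa only [Matrix.frobenius_norm_transpose] using Matrix.frobenius_norm_mul (R - G)ᵀ (R - G)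

lemma norm_overlap_sub_overlap_le (hG : IsOrth (rowBlock G)) (hR : IsOrth (rowBlock R))
    (hS : IsOrth (rowBlock S)) :
    ‖overlap G R - overlap G S‖ ≤ 1 / 2 * (‖R - G‖ + ‖S - G‖) * ‖R - S‖ := by
  have hdiff : overlap G R - overlap G S
      = -((1 / 2 : ℝ) • ((R - G)ᵀ * (R - S) + (R - S)ᵀ * (S - G))) := by
    rw [overlap_eq hG hR, overlap_eq hG hS, sub_sub_sub_cancel_left, ← smul_sub, ← smul_neg]
    congr 1
    simp only [Matrix.transpose_sub, Matrix.sub_mul, Matrix.mul_sub]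
    abel
  have hRG := Matrix.frobenius_norm_mul (R - G)ᵀ (R - S)
  have hSG := Matrix.frobenius_norm_mul (R - S)ᵀ (S - G)
  rw [Matrix.frobenius_norm_transpose] at hRG hSG
  rw [hdiff, norm_neg, norm_smul, Real.norm_of_nonneg (by norm_num), mul_assoc]
  exact mul_le_mul_of_nonneg_left ((norm_add_le _ _).trans (by linarith)) (by norm_num)

end Overlap

section FixedPoint

variable {n d : ℕ} {G : Stack n d} {N N' : BigMatrix n d} {R S R' S' : Stack n d}

/-- The matrix whose blockwise polar factors define the clipped power iteration with noise `N`.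
Without clipping it differs from `(G Gᵀ + N) R` only in that `Gᵀ R` is replaced by its symmetric
part, which removes the freedom of multiplying `R` by an element of `O(d)` from the right. -/
noncomputable def target (G : Stack n d) (N : BigMatrix n d) (R : Stack n d) : Stack n d :=
  G * overlap G R + clipStack ((n : ℝ) / 8) (N * R)

/-- The stacks with orthogonal blocks at distance at most `√n / 4` from `G`. -/
def signalBall (G : Stack n d) : Set (Stack n d) :=
  {R | IsOrth (rowBlock R) ∧ ‖R - G‖ ≤ √n / 4}

/-- Every block of `R` is a polar factor of the corresponding block of `Y`. -/
def IsPolarStack (ℓ : ℝ) (Y R : Stack n d) : Prop := ∀ i, IsPolar ℓ (rowBlock Y i) (rowBlock R i)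

/-- `R` is a fixed point, near `G`, of the clipped power iteration. -/
def IsClippedFixedPoint (G : Stack n d) (N : BigMatrix n d) (R : Stack n d) : Prop :=
  R ∈ signalBall G ∧ IsPolarStack (3 / 4 * (n : ℝ)) (target G N R) R

lemma norm_sub_sq_le_of_mem_signalBall (hR : R ∈ signalBall G) : ‖R - G‖ ^ 2 ≤ n / 16 := by
  have h := pow_le_pow_left₀ (norm_nonneg _) hR.2 2
  rw [div_pow, Real.sq_sqrt (Nat.cast_nonneg n)] at h
  linarith

lemma isClosed_signalBall (G : Stack n d) : IsClosed (signalBall G) :=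
  isClosed_isOrth.inter <|
    isClosed_le (continuous_id.sub continuous_const).norm continuous_const

lemma IsPolarStack.mul_norm_sub_le {ℓ : ℝ} (hℓ : 0 < ℓ) {Y Z : Stack n d}
    (hR : IsPolarStack ℓ Y R) (hS : IsPolarStack ℓ Z S) : ℓ * ‖R - S‖ ≤ ‖Y - Z‖ := by
  rw [← le_inv_mul_iff₀ hℓ]
  refine norm_le_of_rowBlock_le (by positivity) fun i => ?_
  rw [le_inv_mul_iff₀ hℓ]
  exact (hR i).mul_norm_sub_le (hS i)

lemma isPolarStack_smul_self (hG : IsOrth (rowBlock G)) :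
    IsPolarStack (3 / 4 * (n : ℝ)) ((n : ℝ) • G) G :=
  fun i => isPolar_smul_self (by linarith [(Nat.cast_nonneg n : (0 : ℝ) ≤ n)]) (hG i)

lemma norm_rowBlock_target_sub_le (hG : IsOrth (rowBlock G)) (hR : IsOrth (rowBlock R))
    (N : BigMatrix n d) (i : Fin n) :
    ‖rowBlock (target G N R) i - (n : ℝ) • rowBlock G i‖
      ≤ 1 / 2 * ‖R - G‖ ^ 2 + ‖clip ((n : ℝ) / 8) (rowBlock (N * R) i)‖ := by
  have hdecomp : rowBlock (target G N R) i - (n : ℝ) • rowBlock G i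
      = rowBlock G i * (overlap G R - (n : ℝ) • 1) + clip ((n : ℝ) / 8) (rowBlock (N * R) i) := by
    rw [Matrix.mul_sub, Matrix.mul_smul, Matrix.mul_one, sub_add_eq_add_sub]
    rfl
  rw [hdecomp]
  refine (norm_add_le _ _).trans (add_le_add_left ?_ _)
  rw [hG.norm_rowBlock_mul]
  exact norm_overlap_sub_le hG hR

lemma exists_isPolarStack_target (hn : 0 < n) (hG : IsOrth (rowBlock G)) (hR : R ∈ signalBall G)
    (N : BigMatrix n d) : ∃ S, IsPolarStack (3 / 4 * (n : ℝ)) (target G N R) S := by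
  have hn' : (0 : ℝ) < n := by exact_mod_cast hn
  have hpolar (i : Fin n) : ∃ U, IsPolar (3 / 4 * (n : ℝ)) (rowBlock (target G N R) i) U := by
    refine exists_isPolar_of_norm_sub_le (c := n) (by positivity) (hG i) ?_
    have hsub := norm_rowBlock_target_sub_le hG hR.1 N i
    have hclip := norm_clip_le (show 0 < (n : ℝ) / 8 by positivity) (rowBlock (N * R) i)
    linarith [norm_sub_sq_le_of_mem_signalBall hR]
  choose U hU using hpolar
  exact ⟨stack U, hU⟩

lemma norm_target_sub_target_le (hn : 0 < n) (hG : IsOrth (rowBlock G)) (hR : R ∈ signalBall G)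
    (hS : S ∈ signalBall G) (hN : opNorm N ≤ n / 16) :
    ‖target G N R - target G N S‖ ≤ 3 / 8 * n * ‖R - S‖ := by
  have hn' : (0 : ℝ) < n := by exact_mod_cast hn
  have hdecomp : target G N R - target G N S = G * (overlap G R - overlap G S)
      + (clipStack ((n : ℝ) / 8) (N * R) - clipStack ((n : ℝ) / 8) (N * S)) := by
    rw [target, target, Matrix.mul_sub]; abel
  have hoverlap : ‖overlap G R - overlap G S‖ ≤ √n / 4 * ‖R - S‖ :=
    (norm_overlap_sub_overlap_le hG hR.1 hS.1).trans
      (mul_le_mul_of_nonneg_right (by linarith [hR.2, hS.2]) (norm_nonneg _))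
  have hsignal : ‖G * (overlap G R - overlap G S)‖ ≤ n / 4 * ‖R - S‖ := by
    rw [hG.norm_mul]
    refine (mul_le_mul_of_nonneg_left hoverlap (Real.sqrt_nonneg _)).trans_eq ?_
    rw [← mul_assoc, mul_div_assoc', Real.mul_self_sqrt hn'.le]
  have hnoise : ‖clipStack ((n : ℝ) / 8) (N * R) - clipStack ((n : ℝ) / 8) (N * S)‖
      ≤ 2 * (n / 16 * ‖R - S‖) := by
    refine (norm_clipStack_sub_le (by positivity) _ _).trans ?_
    rw [← Matrix.mul_sub]
    gcongr
    exact (norm_mul_le_opNorm_mul N _).trans (mul_le_mul_of_nonneg_right hN (norm_nonneg _))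
  rw [hdecomp]
  exact (norm_add_le _ _).trans (by linarith)

lemma norm_target_sub_le (hn : 0 < n) (hG : IsOrth (rowBlock G)) (hR : IsOrth (rowBlock R)) :
    ‖target G N R - (n : ℝ) • G‖ ≤ √n * (1 / 2 * ‖R - G‖ ^ 2 + opNorm N * √d) := by
  have : (0 : ℝ) < n := by exact_mod_cast hn
  have hdecomp : target G N R - (n : ℝ) • G = G * (overlap G R - (n : ℝ) • 1)
      + clipStack ((n : ℝ) / 8) (N * R) := by
    rw [target, Matrix.mul_sub, Matrix.mul_smul, Matrix.mul_one]; abel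
  have hsignal : ‖G * (overlap G R - (n : ℝ) • 1)‖ ≤ √n * (1 / 2 * ‖R - G‖ ^ 2) := by
    rw [hG.norm_mul]
    exact mul_le_mul_of_nonneg_left (norm_overlap_sub_le hG hR) (Real.sqrt_nonneg _)
  have hnoise : ‖clipStack ((n : ℝ) / 8) (N * R)‖ ≤ √n * (opNorm N * √d) := by
    refine (norm_clipStack_le (by positivity) _).trans ((norm_mul_le_opNorm_mul N R).trans_eq ?_)
    rw [hR.norm_eq, mul_left_comm]
  rw [hdecomp, mul_add]
  exact (norm_add_le _ _).trans (add_le_add hsignal hnoise)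

lemma mem_signalBall_of_isPolarStack_target (hn : 0 < n) (hG : IsOrth (rowBlock G))
    (hR : R ∈ signalBall G) (hN : opNorm N * √d ≤ n / 16)
    (hR' : IsPolarStack (3 / 4 * (n : ℝ)) (target G N R) R') : R' ∈ signalBall G := by
  have hn' : (0 : ℝ) < n := by exact_mod_cast hn
  refine ⟨fun i => (hR' i).1, ?_⟩
  have hpolar := hR'.mul_norm_sub_le (by positivity) (isPolarStack_smul_self hG)
  have htarget : ‖target G N R - (n : ℝ) • G‖ ≤ √n * (3 / 32 * n) :=
    (norm_target_sub_le hn hG hR.1).trans <| mul_le_mul_of_nonneg_left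
      (by linarith [norm_sub_sq_le_of_mem_signalBall hR]) (Real.sqrt_nonneg _)
  have hpos : 0 ≤ √n * (n : ℝ) := by positivity
  exact le_of_mul_le_mul_left (by linarith : (n : ℝ) * ‖R' - G‖ ≤ n * (√n / 4)) hn'

lemma norm_sub_le_half_of_isPolarStack_target (hn : 0 < n) (hG : IsOrth (rowBlock G))
    (hR : R ∈ signalBall G) (hS : S ∈ signalBall G) (hN : opNorm N ≤ n / 16)
    (hR' : IsPolarStack (3 / 4 * (n : ℝ)) (target G N R) R')
    (hS' : IsPolarStack (3 / 4 * (n : ℝ)) (target G N S) S') : ‖R' - S'‖ ≤ 1 / 2 * ‖R - S‖ := by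
  have hn' : (0 : ℝ) < n := by exact_mod_cast hn
  have hpolar := hR'.mul_norm_sub_le (by positivity) hS'
  have htarget := norm_target_sub_target_le hn hG hR hS hN
  exact le_of_mul_le_mul_left (by linarith) hn'

lemma exists_isClippedFixedPoint (hn : 0 < n) (hG : IsOrth (rowBlock G))
    (hN : opNorm N * √d ≤ n / 16) : ∃ R, IsClippedFixedPoint G N R := by
  choose! f hf using fun R (hR : R ∈ signalBall G) => exists_isPolarStack_target hn hG hR N
  have hmaps : Set.MapsTo f (signalBall G) (signalBall G) := fun R hR =>
    mem_signalBall_of_isPolarStack_target hn hG hR hN (hf R hR)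
  have hcontr : ContractingWith (1 / 2) (hmaps.restrict f (signalBall G) (signalBall G)) := by
    refine ⟨by rw [div_lt_one] <;> norm_num, LipschitzWith.of_dist_le_mul fun R S => ?_⟩
    rw [Subtype.dist_eq, Subtype.dist_eq, dist_eq_norm, dist_eq_norm]
    simpa using norm_sub_le_half_of_isPolarStack_target hn hG R.2 S.2
      (opNorm_le_of_mul_sqrt_le hN) (hf R R.2) (hf S S.2)
  have hmem : G ∈ signalBall G := ⟨hG, by rw [sub_self, norm_zero]; positivity⟩
  obtain ⟨R, hR, hfix, -⟩ := hcontr.exists_fixedPoint' (isClosed_signalBall G).isComplete hmaps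
    hmem (edist_ne_top _ _)
  exact ⟨R, hR, by simpa only [hfix.eq] using hf R hR⟩

lemma IsClippedFixedPoint.mul_norm_sub_le (hn : 0 < n) (hG : IsOrth (rowBlock G))
    (hR : IsClippedFixedPoint G N R) (hS : IsClippedFixedPoint G N' S) (hN : opNorm N ≤ n / 16) :
    3 / 8 * n * ‖R - S‖ ≤ 2 * ‖(N - N') * S‖ := by
  have : (0 : ℝ) < n := by exact_mod_cast hn
  have hpolar := hR.2.mul_norm_sub_le (by positivity) hS.2
  have hpoint := norm_target_sub_target_le hn hG hR.1 hS.1 hN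
  have hnoise : ‖target G N S - target G N' S‖ ≤ 2 * ‖(N - N') * S‖ := by
    rw [target, target, add_sub_add_left_eq_sub, Matrix.sub_mul]
    exact norm_clipStack_sub_le (by positivity) _ _
  linarith [norm_sub_le_norm_sub_add_norm_sub (target G N R) (target G N S) (target G N' S)]

lemma IsClippedFixedPoint.norm_sub_signal_le (hn : 0 < n) (hG : IsOrth (rowBlock G))
    (hR : IsClippedFixedPoint G N R) {η : ℝ} (hη : opNorm N * √d ≤ η * n) :
    ‖R - G‖ ≤ 8 / 5 * η * √n := by
  have hn' : (0 : ℝ) < n := by exact_mod_cast hn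
  have hpolar := hR.2.mul_norm_sub_le (by positivity) (isPolarStack_smul_self hG)
  have htarget := norm_target_sub_le (N := N) hn hG hR.1.1
  have hquad : √n * (1 / 2 * ‖R - G‖ ^ 2) ≤ n / 8 * ‖R - G‖ := by
    calc √n * (1 / 2 * ‖R - G‖ ^ 2) = √n * (1 / 2 * ‖R - G‖) * ‖R - G‖ := by ring
      _ ≤ √n * (1 / 2 * (√n / 4)) * ‖R - G‖ := by gcongr; exact hR.1.2
      _ = √n * √n / 8 * ‖R - G‖ := by ring
      _ = n / 8 * ‖R - G‖ := by rw [Real.mul_self_sqrt hn'.le]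
  have hnoise : √n * (opNorm N * √d) ≤ √n * (η * n) :=
    mul_le_mul_of_nonneg_left hη (Real.sqrt_nonneg _)
  exact le_of_mul_le_mul_left (by linarith : (n : ℝ) * ‖R - G‖ ≤ n * (8 / 5 * η * √n)) hn'

end FixedPoint

section BlockDiag

variable {n d : ℕ} (Λ : Fin n → Matrix (Fin d) (Fin d) ℝ)

/-- The block diagonal matrix with blocks `Λ i`. In `Matrix.blockDiagonal` the block index is the
second component, hence the swap. -/
def blockDiag : BigMatrix n d := (Matrix.blockDiagonal Λ).submatrix Prod.swap Prod.swap

lemma transpose_blockDiag : (blockDiag Λ)ᵀ = blockDiag fun i => (Λ i)ᵀ := by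
  rw [blockDiag, Matrix.transpose_submatrix, Matrix.blockDiagonal_transpose, blockDiag]

lemma rowBlock_blockDiag_mul (R : Stack n d) (i : Fin n) :
    rowBlock (blockDiag Λ * R) i = Λ i * rowBlock R i := by
  ext a b
  simp [rowBlock, blockDiag, Matrix.blockDiagonal_apply, Matrix.mul_apply, Fintype.sum_prod_type,
    ite_mul, Finset.sum_ite_irrel]

lemma trace_blockDiag_mul (Y : BigMatrix n d) :
    (blockDiag Λ * Y).trace = ∑ i, (Λ i * block Y i i).trace := by
  simp [block, blockDiag, Matrix.blockDiagonal_apply, Matrix.trace, Matrix.mul_apply,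
    Fintype.sum_prod_type, ite_mul, Finset.sum_ite_irrel]

lemma dotProduct_blockDiag_mulVec (u : Fin n × Fin d → ℝ) :
    u ⬝ᵥ (blockDiag Λ *ᵥ u) = ∑ i, (fun a => u (i, a)) ⬝ᵥ (Λ i *ᵥ fun a => u (i, a)) := by
  simp [blockDiag, Matrix.blockDiagonal_apply, dotProduct, Matrix.mulVec, Fintype.sum_prod_type,
    ite_mul, Finset.sum_ite_irrel]

end BlockDiag

section Gram

variable {n d : ℕ} {A : BigMatrix n d} {R S : Fin n → Matrix (Fin d) (Fin d) ℝ}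

lemma gram_rowBlock (R : Stack n d) : gram (rowBlock R) = R * Rᵀ := rfl

lemma isFeasible_gram (hR : IsOrth R) : IsFeasible (gram R) :=
  ⟨Matrix.posSemidef_self_mul_conjTranspose (stack R),
    fun i => mul_transpose_of_mem_orthogonalGroup (hR i)⟩

lemma matInner_comm {m : Type*} [Fintype m] (X Y : Matrix m m ℝ) :
    matInner X Y = matInner Y X := by
  simp only [matInner, trace_transpose_mul_eq_sum, mul_comm]

lemma matInner_transpose {m : Type*} [Fintype m] (X Y : Matrix m m ℝ) :
    matInner Xᵀ Yᵀ = matInner X Y := by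
  simp only [matInner, trace_transpose_mul_eq_sum, Matrix.transpose_apply]
  exact Finset.sum_comm

lemma matInner_eq_sum_block (X Y : BigMatrix n d) :
    matInner X Y = ∑ i, ∑ j, matInner (block X i j) (block Y i j) := by
  simp only [matInner, trace_transpose_mul_eq_sum, Fintype.sum_prod_type, block, Matrix.of_apply]
  exact Finset.sum_congr rfl fun i _ => Finset.sum_comm

lemma sum_sum_eq_of_symm {ι : Type*} [Fintype ι] [LinearOrder ι] [LocallyFiniteOrderTop ι]
    [LocallyFiniteOrderBot ι] {g : ι → ι → ℝ} (hg : ∀ i j, g i j = g j i) :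
    ∑ i, ∑ j, g i j = 2 * (∑ i, ∑ j ∈ Finset.Ioi i, g i j) + ∑ i, g i i := by
  have hsplit (i : ι) : ∑ j, g i j
      = ∑ j ∈ Finset.Ioi i, g i j + ∑ j ∈ Finset.Iio i, g i j + g i i := by
    rw [← Finset.sum_disjUnion (Finset.disjoint_Ioi_Iio i), Finset.Ioi_disjUnion_Iio,
      Finset.compl_eq_univ_sdiff, Finset.sum_sdiff_eq_sub (Finset.subset_univ _),
      Finset.sum_singleton, sub_add_cancel]
  have hswap : ∑ i, ∑ j ∈ Finset.Iio i, g i j = ∑ i, ∑ j ∈ Finset.Ioi i, g i j := by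
    rw [Finset.sum_comm' (s' := fun j => Finset.Ioi j) (t' := Finset.univ) (by simp)]
    exact Finset.sum_congr rfl fun i _ => Finset.sum_congr rfl fun j _ => hg _ _
  simp only [hsplit, Finset.sum_add_distrib, hswap]
  ring

lemma matInner_gram (hA : A.IsSymm) (hR : IsOrth R) :
    matInner A (gram R) = 2 * mleObjective A R + ∑ i, (block A i i).trace := by
  have hgram (i j : Fin n) : block (gram R) i j = R i * (R j)ᵀ := rfl
  have hdiag (i : Fin n) : matInner (R i * (R i)ᵀ) (block A i i) = (block A i i).trace := by
    rw [mul_transpose_of_mem_orthogonalGroup (hR i), matInner, Matrix.transpose_one, Matrix.one_mul]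
  have hsymm (i j : Fin n) : matInner (R i * (R j)ᵀ) (block A i j)
      = matInner (R j * (R i)ᵀ) (block A j i) := by
    have hblock : block A j i = (block A i j)ᵀ := by
      conv_lhs => rw [← hA.eq]
      rfl
    rw [hblock, ← matInner_transpose (R i * _), Matrix.transpose_mul, Matrix.transpose_transpose]
  simp only [matInner_comm A, matInner_eq_sum_block, hgram]
  rw [sum_sum_eq_of_symm hsymm, Finset.sum_congr rfl fun i _ => hdiag i]
  rfl

lemma matInner_gram_le_iff (hA : A.IsSymm) (hR : IsOrth R) (hS : IsOrth S) :
    matInner A (gram R) ≤ matInner A (gram S) ↔ mleObjective A R ≤ mleObjective A S := by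
  rw [matInner_gram hA hR, matInner_gram hA hS]
  constructor <;> intro h <;> linarith

lemma exists_orthogonal_of_gram_eq (hn : 0 < n) (hR : IsOrth R) (hS : IsOrth S)
    (h : gram R = gram S) : ∃ Q ∈ Matrix.orthogonalGroup (Fin d) ℝ, ∀ i, R i = S i * Q := by
  have hblock (i : Fin n) : R i * (R ⟨0, hn⟩)ᵀ = S i * (S ⟨0, hn⟩)ᵀ :=
    congrArg (fun X => block X i ⟨0, hn⟩) h
  refine ⟨(S ⟨0, hn⟩)ᵀ * R ⟨0, hn⟩, mul_mem (Unitary.star_mem (hS _)) (hR _), fun i => ?_⟩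
  rw [← Matrix.mul_assoc, ← hblock, Matrix.mul_assoc,
    transpose_mul_of_mem_orthogonalGroup (hR _), Matrix.mul_one]

end Gram

section PosSemidef

variable {m k : Type*} [Fintype m] [Fintype k] {M Y : Matrix m m ℝ}

open scoped MatrixOrder in
lemma exists_eq_transpose_mul_self (hY : Y.PosSemidef) : ∃ B : Matrix m m ℝ, Y = Bᵀ * B := by
  classical
  exact CStarAlgebra.nonneg_iff_eq_star_mul_self.mp hY.nonneg

lemma trace_mul_nonneg_and_mul_eq_zero (hM : M.PosSemidef) (hY : Y.PosSemidef) :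
    0 ≤ (M * Y).trace ∧ ((M * Y).trace = 0 → M * Y = 0) := by
  obtain ⟨B, rfl⟩ := exists_eq_transpose_mul_self hM
  obtain ⟨C, rfl⟩ := exists_eq_transpose_mul_self hY
  have htrace : (Bᵀ * B * (Cᵀ * C)).trace = ‖B * Cᵀ‖ ^ 2 := by
    rw [frobenius_norm_sq_eq_trace, Matrix.transpose_mul, Matrix.transpose_transpose,
      ← Matrix.mul_assoc, Matrix.trace_mul_comm, Matrix.mul_assoc, Matrix.mul_assoc]
  refine ⟨htrace ▸ sq_nonneg _, fun h => ?_⟩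
  have hzero : B * Cᵀ = 0 := by simpa [h] using htrace.symm
  rw [Matrix.mul_assoc, ← Matrix.mul_assoc B, hzero, Matrix.zero_mul, Matrix.mul_zero]

variable {R : Matrix m k ℝ} {c : ℝ}

lemma mulVec_sub_eq (hMR : M * R = 0) (u : m → ℝ) (c : ℝ) :
    M *ᵥ (u - c⁻¹ • R *ᵥ (Rᵀ *ᵥ u)) = M *ᵥ u := by
  rw [Matrix.mulVec_sub, Matrix.mulVec_smul, Matrix.mulVec_mulVec, hMR, Matrix.zero_mulVec,
    smul_zero, sub_zero]

variable [DecidableEq k]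

lemma transpose_mulVec_sub_eq_zero (hc : c ≠ 0) (hR : Rᵀ * R = c • 1) (u : m → ℝ) :
    Rᵀ *ᵥ (u - c⁻¹ • R *ᵥ (Rᵀ *ᵥ u)) = 0 := by
  rw [Matrix.mulVec_sub, Matrix.mulVec_smul, Matrix.mulVec_mulVec, hR, Matrix.smul_mulVec,
    Matrix.one_mulVec, inv_smul_smul₀ hc, sub_self]

lemma posSemidef_of_pos_on_ker (hc : c ≠ 0) (hR : Rᵀ * R = c • 1) (hM : M.IsSymm)
    (hMR : M * R = 0) (hpos : ∀ u ≠ 0, Rᵀ *ᵥ u = 0 → 0 < u ⬝ᵥ (M *ᵥ u)) : M.PosSemidef := by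
  refine Matrix.PosSemidef.of_dotProduct_mulVec_nonneg hM fun u => ?_
  set v := u - c⁻¹ • R *ᵥ (Rᵀ *ᵥ u)
  have hMv : M *ᵥ v = M *ᵥ u := mulVec_sub_eq hMR u c
  have hform : u ⬝ᵥ (M *ᵥ u) = v ⬝ᵥ (M *ᵥ v) := by
    rw [← hMv, Matrix.dotProduct_mulVec, ← Matrix.mulVec_transpose, hM.eq, ← hMv,
      dotProduct_comm]
  rw [star_trivial, hform]
  rcases eq_or_ne v 0 with h0 | h0
  · rw [h0, zero_dotProduct]
  · exact (hpos v h0 (transpose_mulVec_sub_eq_zero hc hR u)).le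

lemma eq_mul_of_mul_eq_zero (hc : c ≠ 0) (hR : Rᵀ * R = c • 1) (hMR : M * R = 0)
    (hpos : ∀ u ≠ 0, Rᵀ *ᵥ u = 0 → 0 < u ⬝ᵥ (M *ᵥ u)) (hMY : M * Y = 0) :
    Y = c⁻¹ • (R * (Rᵀ * Y)) := by
  refine Matrix.ext_col fun j => ?_
  have hMy : M *ᵥ Y.col j = 0 := congrArg (Matrix.col · j) hMY
  by_contra hne
  have h := hpos (Y.col j - c⁻¹ • R *ᵥ (Rᵀ *ᵥ Y.col j)) (sub_ne_zero.2 hne)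
    (transpose_mulVec_sub_eq_zero hc hR _)
  rw [mulVec_sub_eq hMR, hMy, dotProduct_zero] at h
  exact h.false

end PosSemidef

section Certificate

variable {n d : ℕ} {A Y : BigMatrix n d} {R : Stack n d}
  {Λ : Fin n → Matrix (Fin d) (Fin d) ℝ}

/-- `Λ` is a dual certificate for `R`: the slack matrix `blockDiag Λ - A` of the dual semidefinite
program annihilates the columns of `R` and is positive definite on their orthogonal complement. -/
structure IsCertificate (A : BigMatrix n d) (Λ : Fin n → Matrix (Fin d) (Fin d) ℝ)
    (R : Stack n d) : Prop where
  isOrth : IsOrth (rowBlock R)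
  isSymm : A.IsSymm
  isSymm_slack : (blockDiag Λ - A).IsSymm
  slack_mul : (blockDiag Λ - A) * R = 0
  slack_pos : ∀ u ≠ 0, Rᵀ *ᵥ u = 0 → 0 < u ⬝ᵥ ((blockDiag Λ - A) *ᵥ u)

lemma matInner_eq_sub_trace_slack (hA : A.IsSymm) (hY : IsFeasible Y)
    (Λ : Fin n → Matrix (Fin d) (Fin d) ℝ) :
    matInner A Y = ∑ i, (Λ i).trace - ((blockDiag Λ - A) * Y).trace := by
  rw [matInner, hA.eq, Matrix.sub_mul, Matrix.trace_sub, trace_blockDiag_mul]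
  simp only [hY.2, Matrix.mul_one, sub_sub_cancel]

lemma IsOrth.rank_gram (hn : 0 < n) (hR : IsOrth (rowBlock R)) : (gram (rowBlock R)).rank = d := by
  have hn' : (n : ℝ) ≠ 0 := by exact_mod_cast hn.ne'
  rw [gram_rowBlock, Matrix.rank_self_mul_transpose, ← Matrix.rank_transpose_mul_self,
    hR.transpose_mul_self, Matrix.rank_of_isUnit, Fintype.card_fin]
  rw [Matrix.isUnit_iff_isUnit_det, Matrix.det_smul, Matrix.det_one, mul_one]
  exact (pow_ne_zero _ hn').isUnit

lemma IsFeasible.eq_gram (hn : 0 < n) (hY : IsFeasible Y) (hR : IsOrth (rowBlock R))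
    (hYR : Y = (n : ℝ)⁻¹ • (R * (Rᵀ * Y))) : Y = gram (rowBlock R) := by
  have hYt : Yᵀ = Y := hY.1.isHermitian
  obtain ⟨C, hC⟩ : ∃ C : Matrix (Fin d) (Fin d) ℝ, Y = R * C * Rᵀ := by
    refine ⟨(n : ℝ)⁻¹ • (n : ℝ)⁻¹ • (Rᵀ * Y * R), ?_⟩
    have hYR' : Y = (n : ℝ)⁻¹ • (Y * R * Rᵀ) := by
      conv_lhs => rw [← hYt, hYR]
      simp only [Matrix.transpose_smul, Matrix.transpose_mul, Matrix.transpose_transpose, hYt,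
        Matrix.mul_assoc]
    conv_lhs => rw [hYR, hYR']
    simp only [Matrix.mul_smul, Matrix.smul_mul, Matrix.mul_assoc]
  have hU := transpose_mul_of_mem_orthogonalGroup (hR ⟨0, hn⟩)
  have hC1 : C = 1 := by
    set U := rowBlock R ⟨0, hn⟩
    have hblock : U * C * Uᵀ = 1 := (congrArg (block · _ _) hC).symm.trans (hY.2 ⟨0, hn⟩)
    calc C = Uᵀ * U * C * (Uᵀ * U) := by rw [hU, Matrix.one_mul, Matrix.mul_one]
      _ = Uᵀ * (U * C * Uᵀ) * U := by simp only [Matrix.mul_assoc]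
      _ = 1 := by rw [hblock, Matrix.mul_one, hU]
  rw [hC, hC1, Matrix.mul_one, gram_rowBlock]

namespace IsCertificate

variable (h : IsCertificate A Λ R)

include h

lemma matInner_gram_eq_sum_trace : matInner A (gram (rowBlock R)) = ∑ i, (Λ i).trace := by
  rw [matInner_eq_sub_trace_slack h.isSymm (isFeasible_gram h.isOrth) Λ, gram_rowBlock,
    ← Matrix.mul_assoc, h.slack_mul, Matrix.zero_mul, Matrix.trace_zero, sub_zero]

lemma posSemidef_slack (hn : 0 < n) : (blockDiag Λ - A).PosSemidef :=
  posSemidef_of_pos_on_ker (by exact_mod_cast hn.ne') h.isOrth.transpose_mul_self h.isSymm_slack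
    h.slack_mul h.slack_pos

lemma isSDPSolution_gram (hn : 0 < n) : IsSDPSolution A (gram (rowBlock R)) := by
  refine ⟨isFeasible_gram h.isOrth, fun Y hY => ?_⟩
  rw [h.matInner_gram_eq_sum_trace, matInner_eq_sub_trace_slack h.isSymm hY Λ]
  exact sub_le_self _ (trace_mul_nonneg_and_mul_eq_zero (h.posSemidef_slack hn) hY.1).1

lemma eq_gram_of_matInner_le (hn : 0 < n) (hY : IsFeasible Y)
    (hle : matInner A (gram (rowBlock R)) ≤ matInner A Y) : Y = gram (rowBlock R) := by
  obtain ⟨hnonneg, hzero⟩ := trace_mul_nonneg_and_mul_eq_zero (h.posSemidef_slack hn) hY.1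
  rw [h.matInner_gram_eq_sum_trace, matInner_eq_sub_trace_slack h.isSymm hY Λ] at hle
  exact hY.eq_gram hn h.isOrth <|
    eq_mul_of_mul_eq_zero (by exact_mod_cast hn.ne') h.isOrth.transpose_mul_self h.slack_mul
      h.slack_pos (hzero (le_antisymm (by linarith) hnonneg))

lemma isMLE_iff (hn : 0 < n) (S : Fin n → Matrix (Fin d) (Fin d) ℝ) :
    IsMLE A S ↔ IsOrth S ∧ gram S = gram (rowBlock R) := by
  constructor
  · rintro ⟨hS, hmax⟩
    exact ⟨hS, h.eq_gram_of_matInner_le hn (isFeasible_gram hS) <|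
      (matInner_gram_le_iff h.isSymm h.isOrth hS).2 (hmax _ h.isOrth)⟩
  · rintro ⟨hS, hgram⟩
    refine ⟨hS, fun S' hS' => (matInner_gram_le_iff h.isSymm hS' hS).1 ?_⟩
    exact hgram ▸ (h.isSDPSolution_gram hn).2 _ (isFeasible_gram hS')

lemma isTight (hn : 0 < n) : IsTight A := by
  have hsol := h.isSDPSolution_gram hn
  exact ⟨gram (rowBlock R), hsol,
    fun Y hY => h.eq_gram_of_matInner_le hn hY.1 (hY.2 _ hsol.1), h.isOrth.rank_gram hn,
    ⟨rowBlock R, (h.isMLE_iff hn _).2 ⟨h.isOrth, rfl⟩⟩, h.isMLE_iff hn⟩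

end IsCertificate

end Certificate

lemma isSymm_of_isSymm_mul_self {k : Type*} [Fintype k] [DecidableEq k] {Z : Matrix k k ℝ} {a : ℝ}
    (hsq : (Z * Z).IsSymm) (h : ‖Z + Zᵀ - a • 1‖ < a) : Z.IsSymm := by
  have hanti : (2 * a) • (Z - Zᵀ)
      = -((Z - Zᵀ) * (Z + Zᵀ - a • 1) + (Z + Zᵀ - a • 1) * (Z - Zᵀ)) := by
    rw [Matrix.IsSymm, Matrix.transpose_mul] at hsq
    simp only [Matrix.mul_sub, Matrix.sub_mul, Matrix.mul_add, Matrix.add_mul, Matrix.mul_smul,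
      Matrix.smul_mul, Matrix.mul_one, Matrix.one_mul, hsq]
    module
  have hnorm : 2 * a * ‖Z - Zᵀ‖ ≤ 2 * (‖Z + Zᵀ - a • 1‖ * ‖Z - Zᵀ‖) := by
    have ha : 0 ≤ 2 * a := by linarith [norm_nonneg (Z + Zᵀ - a • 1)]
    rw [← Real.norm_of_nonneg ha, ← norm_smul, hanti, norm_neg]
    exact (norm_add_le _ _).trans
      (by linarith [Matrix.frobenius_norm_mul (Z - Zᵀ) (Z + Zᵀ - a • 1),
        Matrix.frobenius_norm_mul (Z + Zᵀ - a • 1) (Z - Zᵀ)])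
  have hzero : ‖Z - Zᵀ‖ ≤ 0 := by
    by_contra! hpos
    linarith [mul_lt_mul_of_pos_right h hpos]
  exact (sub_eq_zero.1 (norm_le_zero_iff.1 hzero)).symm

section Multiplier

variable {n d : ℕ} {Y R : Stack n d} {ℓ : ℝ}

/-- The symmetric factors in the blockwise polar decomposition of `Y` with polar factor `R`. -/
def multiplier (Y R : Stack n d) (i : Fin n) : Matrix (Fin d) (Fin d) ℝ :=
  rowBlock Y i * (rowBlock R i)ᵀ

lemma IsPolarStack.isSymm_blockDiag_multiplier (h : IsPolarStack ℓ Y R) :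
    (blockDiag (multiplier Y R)).IsSymm := by
  rw [Matrix.IsSymm, transpose_blockDiag]
  exact congrArg blockDiag (funext fun i => (h i).transpose_mul_transpose)

lemma blockDiag_multiplier_mul (hR : IsOrth (rowBlock R)) (Y : Stack n d) :
    blockDiag (multiplier Y R) * R = Y := by
  have hblock (i : Fin n) : rowBlock (blockDiag (multiplier Y R) * R) i = rowBlock Y i := by
    rw [rowBlock_blockDiag_mul, multiplier, Matrix.mul_assoc,
      transpose_mul_of_mem_orthogonalGroup (hR i), Matrix.mul_one]
  exact congrArg stack (funext hblock)

lemma IsPolarStack.mul_dotProduct_le (h : IsPolarStack ℓ Y R) (u : Fin n × Fin d → ℝ) :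
    ℓ * (u ⬝ᵥ u) ≤ u ⬝ᵥ (blockDiag (multiplier Y R) *ᵥ u) := by
  have hsplit : u ⬝ᵥ u = ∑ i, (fun a => u (i, a)) ⬝ᵥ (fun a => u (i, a)) := by
    simp only [dotProduct, Fintype.sum_prod_type]
  rw [dotProduct_blockDiag_mulVec, hsplit, Finset.mul_sum]
  refine Finset.sum_le_sum fun i _ => ?_
  have hpsd := (h i).2.dotProduct_mulVec_nonneg fun a => u (i, a)
  rwa [star_trivial, Matrix.sub_mulVec, Matrix.smul_mulVec, Matrix.one_mulVec, dotProduct_sub,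
    dotProduct_smul, smul_eq_mul, sub_nonneg] at hpsd

end Multiplier

section Tight

variable {n d : ℕ} {G R : Stack n d} {N : BigMatrix n d}

lemma target_eq_of_norm_rowBlock_le (hn : 0 < n) (hrow : ∀ i, ‖rowBlock (N * R) i‖ ≤ n / 8) :
    target G N R = G * overlap G R + N * R := by
  have : (0 : ℝ) < n := by exact_mod_cast hn
  rw [target, clipStack]
  exact congrArg (fun S => G * overlap G R + stack S)
    (funext fun i => clip_of_norm_le (by positivity) (hrow i))

lemma dotProduct_gram_mulVec_le (hR : R ∈ signalBall G) {u : Fin n × Fin d → ℝ}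
    (hu : Rᵀ *ᵥ u = 0) : u ⬝ᵥ (gram (rowBlock G) *ᵥ u) ≤ n / 16 * (u ⬝ᵥ u) := by
  have hdiff : Gᵀ *ᵥ u = -((R - G)ᵀ *ᵥ u) := by
    rw [Matrix.transpose_sub, Matrix.sub_mulVec, hu, zero_sub, neg_neg]
  have hnorm : opNorm ((R - G) * (R - G)ᵀ) ≤ n / 16 := by
    refine (opNorm_le_norm _).trans ((Matrix.frobenius_norm_mul _ _).trans ?_)
    rw [Matrix.frobenius_norm_transpose, ← sq]
    exact norm_sub_sq_le_of_mem_signalBall hR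
  calc u ⬝ᵥ (gram (rowBlock G) *ᵥ u) = (Gᵀ *ᵥ u) ⬝ᵥ (Gᵀ *ᵥ u) := by
        rw [gram_rowBlock, ← Matrix.mulVec_mulVec, Matrix.dotProduct_mulVec,
          ← Matrix.mulVec_transpose]
    _ = u ⬝ᵥ (((R - G) * (R - G)ᵀ) *ᵥ u) := by
        rw [hdiff, neg_dotProduct_neg, ← Matrix.mulVec_mulVec, Matrix.dotProduct_mulVec u,
          ← Matrix.mulVec_transpose]
    _ ≤ opNorm ((R - G) * (R - G)ᵀ) * (u ⬝ᵥ u) := dotProduct_mulVec_le_opNorm _ u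
    _ ≤ n / 16 * (u ⬝ᵥ u) := mul_le_mul_of_nonneg_right hnorm (dotProduct_self_star_nonneg u)

namespace IsClippedFixedPoint

variable (hn : 0 < n) (hG : IsOrth (rowBlock G)) (hR : IsClippedFixedPoint G N R)

include hn hG hR

/- Both `Rᵀ (Λ R)` and `Rᵀ N R` are symmetric, hence so is `(Gᵀ R)ᵀ T` for the symmetric part `T`
of `Gᵀ R`, that is, `(Gᵀ R)²` is symmetric. -/
lemma transpose_mul_eq_overlap (hN : N.IsSymm) (hrow : ∀ i, ‖rowBlock (N * R) i‖ ≤ n / 8) :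
    Gᵀ * R = overlap G R := by
  have hn' : (0 : ℝ) < n := by exact_mod_cast hn
  have hoverlap : (2 : ℝ) • overlap G R = Gᵀ * R + (Gᵀ * R)ᵀ := by
    rw [overlap, smul_smul, Matrix.transpose_mul, Matrix.transpose_transpose]
    norm_num
  have hconj {B : BigMatrix n d} (hB : B.IsSymm) : (Rᵀ * (B * R)).IsSymm := by
    rw [Matrix.IsSymm, Matrix.transpose_mul, Matrix.transpose_mul, hB.eq,
      Matrix.transpose_transpose, Matrix.mul_assoc]
  have hsymm : ((Gᵀ * R)ᵀ * overlap G R).IsSymm := by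
    have hsplit : (Gᵀ * R)ᵀ * overlap G R
        = Rᵀ * (blockDiag (multiplier (target G N R) R) * R) - Rᵀ * (N * R) := by
      rw [blockDiag_multiplier_mul hR.1.1, target_eq_of_norm_rowBlock_le hn hrow, Matrix.mul_add,
        add_sub_cancel_right, Matrix.transpose_mul, Matrix.transpose_transpose, Matrix.mul_assoc]
    rw [hsplit]
    exact (hconj hR.2.isSymm_blockDiag_multiplier).sub (hconj hN)
  have hsq : ((Gᵀ * R) * (Gᵀ * R)).IsSymm := by
    have h := hsymm.smul (2 : ℝ)
    rw [← Matrix.mul_smul, hoverlap, Matrix.mul_add] at h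
    have h' := h.sub (Matrix.isSymm_transpose_mul_self (Gᵀ * R))
    rw [add_sub_cancel_left, ← Matrix.transpose_mul] at h'
    exact Matrix.isSymm_transpose_iff.1 h'
  have hZ : (Gᵀ * R).IsSymm := by
    refine isSymm_of_isSymm_mul_self (a := 2 * n) hsq ?_
    rw [← hoverlap, mul_smul, ← smul_sub, norm_smul, Real.norm_two]
    linarith [norm_overlap_sub_le hG hR.1.1, norm_sub_sq_le_of_mem_signalBall hR.1]
  rw [hZ.eq, ← two_smul ℝ (Gᵀ * R)] at hoverlap
  exact (smul_right_injective _ two_ne_zero hoverlap).symm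

lemma isCertificate (hN : N.IsSymm) (hop : opNorm N ≤ n / 16)
    (hrow : ∀ i, ‖rowBlock (N * R) i‖ ≤ n / 8) :
    IsCertificate (gram (rowBlock G) + N) (multiplier (target G N R) R) R := by
  have hn' : (0 : ℝ) < n := by exact_mod_cast hn
  have hA : (gram (rowBlock G) + N).IsSymm := by
    rw [Matrix.IsSymm, Matrix.transpose_add, gram_rowBlock, Matrix.transpose_mul,
      Matrix.transpose_transpose, hN.eq]
  refine ⟨hR.1.1, hA, hR.2.isSymm_blockDiag_multiplier.sub hA, ?_, fun u hu0 hu => ?_⟩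
  · rw [Matrix.sub_mul, blockDiag_multiplier_mul hR.1.1, Matrix.add_mul, gram_rowBlock,
      Matrix.mul_assoc, hR.transpose_mul_eq_overlap hn hG hN hrow,
      target_eq_of_norm_rowBlock_le hn hrow, sub_self]
  · have hpos : 0 < n * (u ⬝ᵥ u) := mul_pos hn' (Matrix.dotProduct_self_star_pos_iff.2 hu0)
    have hΛ := hR.2.mul_dotProduct_le u
    have hsignal := dotProduct_gram_mulVec_le hR.1 hu
    have hnoise : u ⬝ᵥ (N *ᵥ u) ≤ n / 16 * (u ⬝ᵥ u) :=
      (dotProduct_mulVec_le_opNorm N u).trans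
        (mul_le_mul_of_nonneg_right hop (dotProduct_self_star_nonneg u))
    rw [Matrix.sub_mulVec, Matrix.add_mulVec, dotProduct_sub, dotProduct_add]
    linarith

variable {η : ℝ} (hop : opNorm N * √d ≤ η * n) (hη : η ≤ 1 / 16)
  (hrow : ∀ i, ‖rowBlock (N * R) i‖ ≤ 2 * η * n)

include hop hη hrow

lemma norm_rowBlock_sub_le (i : Fin n) : ‖rowBlock R i - rowBlock G i‖ ≤ 3 * η := by
  have hn' : (0 : ℝ) < n := by exact_mod_cast hn
  have hpos : 0 ≤ η * n := le_trans (mul_nonneg (opNorm_nonneg N) (Real.sqrt_nonneg _)) hop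
  have hpolar := ((hR.2 i).mul_norm_sub_le (isPolarStack_smul_self hG i)).trans
    (norm_rowBlock_target_sub_le hG hR.1.1 N i)
  have hquad : ‖R - G‖ ^ 2 ≤ 4 / 25 * (η * n) := by
    calc ‖R - G‖ ^ 2 ≤ (8 / 5 * η * √n) ^ 2 :=
          pow_le_pow_left₀ (norm_nonneg _) (hR.norm_sub_signal_le hn hG hop) 2
      _ = 64 / 25 * η * (η * n) := by rw [mul_pow, Real.sq_sqrt hn'.le]; ring
      _ ≤ 4 / 25 * (η * n) := mul_le_mul_of_nonneg_right (by linarith) hpos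
  have hclip : ‖clip ((n : ℝ) / 8) (rowBlock (N * R) i)‖ ≤ 2 * η * n :=
    (norm_div_max_smul_le (by positivity) _ _).trans (hrow i)
  exact le_of_mul_le_mul_left (by linarith : (n : ℝ) * ‖_‖ ≤ n * (3 * η)) hn'

lemma isTight_and_blockErrorLE (hN : N.IsSymm) :
    IsTight (gram (rowBlock G) + N) ∧
      ∀ S, IsMLE (gram (rowBlock G) + N) S → BlockErrorLE S (rowBlock G) (3 * η) := by
  have hn' : (0 : ℝ) < n := by exact_mod_cast hn
  have hηn : η * n ≤ n / 16 := by linarith [mul_le_mul_of_nonneg_right hη hn'.le]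
  have hcert := hR.isCertificate hn hG hN (opNorm_le_of_mul_sqrt_le (hop.trans hηn))
    fun i => (hrow i).trans (by linarith)
  refine ⟨hcert.isTight hn, fun S hS => ?_⟩
  obtain ⟨hSorth, hSgram⟩ := (hcert.isMLE_iff hn S).1 hS
  obtain ⟨Q, hQ, hSQ⟩ := exists_orthogonal_of_gram_eq hn hSorth hR.1.1 hSgram
  refine ⟨Q, hQ, fun i => ?_⟩
  rw [hSQ, ← Matrix.sub_mul, ← Matrix.frobenius_norm_transpose, Matrix.transpose_mul]
  refine le_trans (le_of_sq_le_sq ?_ (norm_nonneg _))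
    (hR.norm_rowBlock_sub_le hn hG hop hη hrow i)
  rw [frobenius_norm_sq_mul (c := 1), one_mul, Matrix.frobenius_norm_transpose]
  rw [Matrix.transpose_transpose, one_smul, mul_transpose_of_mem_orthogonalGroup hQ]

end IsClippedFixedPoint

end Tight

section LeaveOneOut

variable {n d : ℕ} {G R S : Stack n d} {N : BigMatrix n d} {i : Fin n}

/-- The orthogonal projection of `ℝ^{nd}` onto the coordinates of the `i`-th block. -/
def blockProj (d : ℕ) (i : Fin n) : BigMatrix n d :=
  Matrix.diagonal fun p => if p.1 = i then 1 else 0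

/-- The matrix `N` with its `i`-th block row and block column replaced by zero. -/
def leaveOut (i : Fin n) (N : BigMatrix n d) : BigMatrix n d :=
  (1 - blockProj d i) * N * (1 - blockProj d i)

lemma one_sub_blockProj (d : ℕ) (i : Fin n) :
    1 - blockProj d i = Matrix.diagonal fun p => if p.1 = i then 0 else 1 := by
  rw [blockProj, ← Matrix.diagonal_one, Matrix.diagonal_sub]
  exact congrArg Matrix.diagonal (funext fun p => by split_ifs <;> norm_num)

lemma leaveOut_apply (i : Fin n) (N : BigMatrix n d) (p q : Fin n × Fin d) :
    leaveOut i N p q = if p.1 = i ∨ q.1 = i then 0 else N p q := by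
  rw [leaveOut, one_sub_blockProj, Matrix.mul_diagonal, Matrix.diagonal_mul]
  split_ifs <;> simp_all

lemma opNorm_one_sub_blockProj_le (d : ℕ) (i : Fin n) : opNorm (1 - blockProj d i) ≤ 1 := by
  rw [one_sub_blockProj, opNorm_diagonal, pi_norm_le_iff_of_nonneg zero_le_one]
  intro p
  split_ifs <;> simp

lemma opNorm_leaveOut_le (i : Fin n) (N : BigMatrix n d) : opNorm (leaveOut i N) ≤ opNorm N := by
  have hproj := opNorm_one_sub_blockProj_le d i
  calc opNorm (leaveOut i N)
      ≤ opNorm ((1 - blockProj d i) * N) * opNorm (1 - blockProj d i) := opNorm_mul_le _ _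
    _ ≤ opNorm ((1 - blockProj d i) * N) := mul_le_of_le_one_right (opNorm_nonneg _) hproj
    _ ≤ opNorm (1 - blockProj d i) * opNorm N := opNorm_mul_le _ _
    _ ≤ opNorm N := mul_le_of_le_one_left (opNorm_nonneg _) hproj

lemma norm_blockProj_mul (i : Fin n) (S : Stack n d) : ‖blockProj d i * S‖ = ‖rowBlock S i‖ := by
  rw [← sq_eq_sq₀ (norm_nonneg _) (norm_nonneg _), norm_sq_eq_sum_rowBlock,
    Finset.sum_eq_single_of_mem i (Finset.mem_univ i)]
  · congr 2
    ext a b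
    simp [rowBlock, blockProj, Matrix.diagonal_mul]
  · intro j _ hj
    rw [sq_eq_zero_iff, norm_eq_zero]
    ext a b
    simp [rowBlock, blockProj, Matrix.diagonal_mul, hj]

lemma norm_sub_leaveOut_mul_le (i : Fin n) (N : BigMatrix n d) (S : Stack n d) :
    ‖(N - leaveOut i N) * S‖ ≤ ‖rowBlock (N * S) i‖ + opNorm N * ‖rowBlock S i‖ := by
  have hsplit : (N - leaveOut i N) * S
      = blockProj d i * (N * S) + (1 - blockProj d i) * (N * (blockProj d i * S)) := by
    rw [leaveOut]
    simp only [Matrix.sub_mul, Matrix.mul_sub, Matrix.one_mul, Matrix.mul_one, Matrix.mul_assoc]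
    abel
  have hcol : ‖(1 - blockProj d i) * (N * (blockProj d i * S))‖ ≤ opNorm N * ‖rowBlock S i‖ := by
    rw [← norm_blockProj_mul]
    refine (norm_mul_le_opNorm_mul _ _).trans ?_
    exact (mul_le_of_le_one_left (norm_nonneg _) (opNorm_one_sub_blockProj_le d i)).trans
      (norm_mul_le_opNorm_mul _ _)
  rw [hsplit]
  exact (norm_add_le _ _).trans (add_le_add (norm_blockProj_mul i _).le hcol)

lemma IsOrth.norm_rowBlock (hR : IsOrth (rowBlock R)) (i : Fin n) : ‖rowBlock R i‖ = √d := by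
  rw [← Real.sqrt_sq (norm_nonneg _), frobenius_norm_sq_of_transpose_mul_self (c := 1),
    Fintype.card_fin, one_mul]
  rw [one_smul, transpose_mul_of_mem_orthogonalGroup (hR i)]

/- `S` solves the fixed point equation of `N` up to the perturbation `(N - leaveOut i N) S`, which
is of the size of the single block row `(N S)_i`; stability of fixed points transfers the smallness
of that row from `S`, where it is independent of the noise, to `R`. -/
lemma IsClippedFixedPoint.norm_rowBlock_mul_le (hn : 0 < n) (hG : IsOrth (rowBlock G))
    (hR : IsClippedFixedPoint G N R) (hS : IsClippedFixedPoint G (leaveOut i N) S) {η : ℝ}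
    (hop : opNorm N * √d ≤ η * n) (hη : η ≤ 1 / 16) (hrow : ‖rowBlock (N * S) i‖ ≤ η * n) :
    ‖rowBlock (N * R) i‖ ≤ 2 * η * n := by
  have hN : opNorm N ≤ n / 16 := opNorm_le_of_mul_sqrt_le <| hop.trans <| by
    linarith [mul_le_mul_of_nonneg_right hη (Nat.cast_nonneg (α := ℝ) n)]
  have hdiff : ‖(N - leaveOut i N) * S‖ ≤ 2 * (η * n) := by
    refine (norm_sub_leaveOut_mul_le i N S).trans ?_
    rw [hS.1.1.norm_rowBlock]
    linarith
  have hstable := hR.mul_norm_sub_le hn hG hS hN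
  have hsplit : rowBlock (N * R) i = rowBlock (N * S) i + rowBlock (N * (R - S)) i := by
    rw [Matrix.mul_sub]
    exact (add_sub_cancel _ _).symm
  have hrem : ‖rowBlock (N * (R - S)) i‖ ≤ n / 16 * ‖R - S‖ :=
    (norm_rowBlock_le _ i).trans ((norm_mul_le_opNorm_mul N _).trans
      (mul_le_mul_of_nonneg_right hN (norm_nonneg _)))
  rw [hsplit]
  exact (norm_add_le _ _).trans (by linarith [norm_nonneg (rowBlock (N * S) i)])

open Classical in
/-- A fixed point of the clipped power iteration with noise `N` when the noise is small, and `G`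
otherwise, so that the blocks are orthogonal for every `N`. -/
noncomputable def clippedFixedPoint (G : Stack n d) (N : BigMatrix n d) : Stack n d :=
  if h : opNorm N * √d ≤ n / 16 ∧ ∃ R, IsClippedFixedPoint G N R then h.2.choose else G

lemma isClippedFixedPoint_clippedFixedPoint (hn : 0 < n) (hG : IsOrth (rowBlock G))
    (hN : opNorm N * √d ≤ n / 16) : IsClippedFixedPoint G N (clippedFixedPoint G N) := by
  have h := And.intro hN (exists_isClippedFixedPoint hn hG hN)
  rw [clippedFixedPoint, dif_pos h]
  exact h.2.choose_spec

lemma isOrth_clippedFixedPoint (hG : IsOrth (rowBlock G)) (N : BigMatrix n d) :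
    IsOrth (rowBlock (clippedFixedPoint G N)) := by
  unfold clippedFixedPoint
  split_ifs with h
  · exact h.2.choose_spec.1.1
  · exact hG

lemma continuousOn_clippedFixedPoint (hn : 0 < n) (hG : IsOrth (rowBlock G)) :
    ContinuousOn (clippedFixedPoint G) {N | opNorm N * √d ≤ n / 16} := by
  have : (0 : ℝ) < n := by exact_mod_cast hn
  refine (LipschitzOnWith.of_dist_le' (K := 16 / (3 * n) * (√n * √d))
    fun N hN N' hN' => ?_).continuousOn
  have hfix {N : BigMatrix n d} := isClippedFixedPoint_clippedFixedPoint (N := N) hn hG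
  have hstable := (hfix hN).mul_norm_sub_le hn hG (hfix hN') (opNorm_le_of_mul_sqrt_le hN)
  have hnoise := Matrix.frobenius_norm_mul (N - N') (clippedFixedPoint G N')
  rw [(isOrth_clippedFixedPoint hG N').norm_eq] at hnoise
  rw [dist_eq_norm, dist_eq_norm, div_mul_eq_mul_div, div_mul_eq_mul_div,
    le_div_iff₀ (by positivity)]
  linarith

lemma measurable_clippedFixedPoint_apply (hn : 0 < n) (hG : IsOrth (rowBlock G)) {X : Type*}
    [TopologicalSpace X] [MeasurableSpace X] [OpensMeasurableSpace X] {f : X → BigMatrix n d}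
    (hf : Continuous f) (p : Fin n × Fin d) (c : Fin d) :
    Measurable fun x => clippedFixedPoint G (f x) p c := by
  classical
  set s : Set X := {x | opNorm (f x) * √d ≤ n / 16}
  have hs : IsClosed s :=
    isClosed_le ((continuous_opNorm.comp hf).mul continuous_const) continuous_const
  have hpiece : (fun x => clippedFixedPoint G (f x) p c)
      = s.piecewise (fun x => clippedFixedPoint G (f x) p c) fun _ => G p c := by
    funext x
    by_cases hx : x ∈ s
    · rw [Set.piecewise_eq_of_mem _ _ _ hx]
    · rw [Set.piecewise_eq_of_notMem _ _ _ hx, clippedFixedPoint, dif_neg fun h => hx h.1]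
  rw [hpiece]
  refine ContinuousOn.measurable_piecewise ?_ continuousOn_const hs.measurableSet
  exact (continuous_id.matrix_elem p c).comp_continuousOn <|
    (continuousOn_clippedFixedPoint hn hG).comp hf.continuousOn fun x hx => hx

lemma isTight_and_blockErrorLE_of_leaveOut (hn : 0 < n) (hG : IsOrth (rowBlock G)) (hN : N.IsSymm)
    {η : ℝ} (hop : opNorm N * √d ≤ η * n) (hη : η ≤ 1 / 16)
    (hrow : ∀ i, ‖rowBlock (N * clippedFixedPoint G (leaveOut i N)) i‖ ≤ η * n) :
    IsTight (gram (rowBlock G) + N) ∧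
      ∀ S, IsMLE (gram (rowBlock G) + N) S → BlockErrorLE S (rowBlock G) (3 * η) := by
  have hN16 : opNorm N * √d ≤ n / 16 := hop.trans <| by
    linarith [mul_le_mul_of_nonneg_right hη (Nat.cast_nonneg (α := ℝ) n)]
  have hR := isClippedFixedPoint_clippedFixedPoint hn hG hN16
  refine hR.isTight_and_blockErrorLE hn hG hop hη (fun i => ?_) hN
  refine hR.norm_rowBlock_mul_le hn hG (isClippedFixedPoint_clippedFixedPoint hn hG ?_) hop hη
    (hrow i)
  exact (mul_le_mul_of_nonneg_right (opNorm_leaveOut_le i N) (Real.sqrt_nonneg _)).trans hN16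

end LeaveOneOut

section Averaging

open Metric

lemma mul_measure_le_of_forall_measure_le {X Y : Type*} [MeasurableSpace X] [MeasurableSpace Y]
    {μ : Measure X} {ν : Measure Y} [SFinite μ] [SFinite ν] {D : Set (X × Y)}
    (hD : MeasurableSet D) {B : Set X} {b ε : ENNReal}
    (hB : ∀ x ∈ B, b ≤ ν (Prod.mk x ⁻¹' D)) (hε : ∀ᵐ y ∂ν, μ ((fun x => (x, y)) ⁻¹' D) ≤ ε) :
    b * μ B ≤ ε * ν Set.univ := by
  calc b * μ B ≤ b * μ {x | b ≤ ν (Prod.mk x ⁻¹' D)} := mul_right_mono (measure_mono hB)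
    _ ≤ ∫⁻ x, ν (Prod.mk x ⁻¹' D) ∂μ :=
        mul_meas_ge_le_lintegral (measurable_measure_prodMk_left hD) b
    _ = ∫⁻ y, μ ((fun x => (x, y)) ⁻¹' D) ∂ν := by
        rw [← Measure.prod_apply hD, Measure.prod_apply_symm hD]
    _ ≤ ∫⁻ _, ε ∂ν := lintegral_mono_ae hε
    _ = ε * ν Set.univ := lintegral_const ε

variable {E F : Type*} [NormedAddCommGroup E] [NormedSpace ℝ E] [NormedAddCommGroup F]
  [NormedSpace ℝ F]

lemma exists_forall_mem_ball_half_opNorm_le {T : E →L[ℝ] F} (hT : T ≠ 0) :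
    ∃ v, ‖v‖ < 1 ∧ ∀ u ∈ ball v (1 / 4), ‖T‖ / 2 ≤ ‖T u‖ := by
  have hpos : 0 < ‖T‖ := norm_pos_iff.2 hT
  obtain ⟨v, hv, hTv⟩ := T.exists_lt_apply_of_lt_opNorm (by linarith : 3 / 4 * ‖T‖ < ‖T‖)
  refine ⟨v, hv, fun u hu => ?_⟩
  have hdiff : ‖T v - T u‖ ≤ ‖T‖ * (1 / 4) := by
    rw [← map_sub]
    exact T.le_opNorm_of_le (by rw [← dist_eq_norm, dist_comm]; exact hu.le)
  linarith [norm_le_norm_add_norm_sub (T u) (T v), norm_sub_rev (T u) (T v)]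

/- The maximum over a net of the unit ball is replaced by an average over the ball of radius `5/4`:
whenever `κ ≤ ‖T x‖`, one has `κ / 2 ≤ ‖T x u‖` on a ball of radius `1/4` inside it. -/
lemma measure_opNorm_ge_le [FiniteDimensional ℝ E] [MeasurableSpace E] [BorelSpace E]
    {X : Type*} [MeasurableSpace X] {μ : Measure X} [SFinite μ] {T : X → E →L[ℝ] F}
    (hT : Measurable fun z : X × E => ‖T z.1 z.2‖) {κ : ℝ} (hκ : 0 < κ) {ε : ENNReal}
    (hε : ∀ u, ‖u‖ ≤ 5 / 4 → μ {x | κ / 2 ≤ ‖T x u‖} ≤ ε) :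
    μ {x | κ ≤ ‖T x‖} ≤ 5 ^ Module.finrank ℝ E * ε := by
  set ν : Measure E := Measure.addHaar
  set b : ENNReal := ν (ball 0 (1 / 4))
  have hb : b ≠ 0 := (measure_ball_pos _ _ (by norm_num)).ne'
  have hball : ν (ball 0 (5 / 4)) = 5 ^ Module.finrank ℝ E * b := by
    have h := Measure.addHaar_ball_mul_of_pos ν 0 (show (0 : ℝ) < 5 by norm_num) (1 / 4)
    rw [ENNReal.ofReal_pow (by norm_num), ENNReal.ofReal_ofNat] at h
    rw [← h]
    norm_num
  have hD : MeasurableSet {z : X × E | κ / 2 ≤ ‖T z.1 z.2‖} := measurableSet_le measurable_const hT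
  have hlarge : ∀ x ∈ {x | κ ≤ ‖T x‖},
      b ≤ ν.restrict (ball 0 (5 / 4)) (Prod.mk x ⁻¹' {z | κ / 2 ≤ ‖T z.1 z.2‖}) := by
    intro x (hx : κ ≤ ‖T x‖)
    obtain ⟨v, hv, hTu⟩ := exists_forall_mem_ball_half_opNorm_le (norm_pos_iff.1 (hκ.trans_le hx))
    rw [Measure.restrict_apply (measurable_prodMk_left hD),
      show b = ν (ball v (1 / 4)) from (Measure.addHaar_ball_center ν v (1 / 4)).symm]
    refine measure_mono fun u hu => ⟨(by linarith : κ / 2 ≤ ‖T x‖ / 2).trans (hTu u hu), ?_⟩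
    rw [mem_ball_zero_iff]
    linarith [norm_le_norm_add_norm_sub' u v, mem_ball_iff_norm.1 hu]
  have hsmall : ∀ᵐ u ∂ν.restrict (ball 0 (5 / 4)),
      μ ((fun x => (x, u)) ⁻¹' {z | κ / 2 ≤ ‖T z.1 z.2‖}) ≤ ε :=
    (ae_restrict_mem measurableSet_ball).mono fun u hu => hε u (mem_ball_zero_iff.1 hu).le
  have h := mul_measure_le_of_forall_measure_le hD hlarge hsmall
  rw [Measure.restrict_apply_univ, hball, ← mul_assoc, mul_comm _ b, mul_comm ε] at h
  exact (ENNReal.mul_le_mul_iff_right hb measure_ball_lt_top.ne).1 h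

end Averaging

section StdGauss

open NNReal

variable {ι : Type*} [Fintype ι]

/-- The standard Gaussian measure on `ℝ^ι`. -/
noncomputable abbrev stdGauss (ι : Type*) [Fintype ι] : Measure (ι → ℝ) :=
  Measure.pi fun _ => gaussianReal 0 1

lemma hasSubgaussianMGF_id_gaussianReal (v : ℝ≥0) : HasSubgaussianMGF id v (gaussianReal 0 v) :=
  ⟨fun t => integrable_exp_mul_gaussianReal t, fun t => by simp [mgf_id_gaussianReal]⟩

lemma hasSubgaussianMGF_apply_stdGauss (e : ι) :
    HasSubgaussianMGF (fun x : ι → ℝ => x e) 1 (stdGauss ι) := by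
  refine HasSubgaussianMGF.of_map (X := id) (Y := fun x : ι → ℝ => x e)
    (measurable_pi_apply e).aemeasurable ?_
  rw [(measurePreserving_eval (fun _ : ι => gaussianReal 0 1) e).map_eq]
  exact hasSubgaussianMGF_id_gaussianReal 1

lemma linearMap_apply_eq_sum [DecidableEq ι] (g : (ι → ℝ) →ₗ[ℝ] ℝ) (x : ι → ℝ) :
    g x = ∑ e, g (Pi.single e 1) * x e := by
  rw [g.pi_apply_eq_sum_univ x]
  refine Finset.sum_congr rfl fun e _ => ?_
  rw [smul_eq_mul, mul_comm]
  congr 2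
  ext e'
  simp only [Pi.single_apply, eq_comm]

lemma sum_sq_apply_single_le [DecidableEq ι] {g : (ι → ℝ) →ₗ[ℝ] ℝ} {V : ℝ≥0}
    (hg : ∀ x, g x ^ 2 ≤ V * ∑ e, x e ^ 2) : ∑ e, g (Pi.single e 1) ^ 2 ≤ V := by
  have h := hg fun e => g (Pi.single e 1)
  rw [linearMap_apply_eq_sum] at h
  simp only [← sq] at h
  rcases (Finset.sum_nonneg fun e _ => sq_nonneg (g (Pi.single e 1))).eq_or_lt' with h0 | hpos
  · exact h0.trans_le V.2
  · exact le_of_mul_le_mul_right ((sq _).symm.trans_le h) hpos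

lemma hasSubgaussianMGF_linearMap_stdGauss {g : (ι → ℝ) →ₗ[ℝ] ℝ} {V : ℝ≥0}
    (hg : ∀ x, g x ^ 2 ≤ V * ∑ e, x e ^ 2) : HasSubgaussianMGF g V (stdGauss ι) := by
  classical
  have hindep : iIndepFun (fun e (x : ι → ℝ) => g (Pi.single e 1) * x e) (stdGauss ι) :=
    iIndepFun_pi (X := fun e (y : ℝ) => g (Pi.single e 1) * y) fun e => by fun_prop
  have hsum := HasSubgaussianMGF.sum_of_iIndepFun hindep (s := Finset.univ)
    fun e _ => (hasSubgaussianMGF_apply_stdGauss e).const_mul (g (Pi.single e 1))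
  simp only [← linearMap_apply_eq_sum] at hsum
  refine ⟨hsum.integrable_exp_mul, fun t => (hsum.mgf_le t).trans ?_⟩
  gcongr
  refine NNReal.coe_le_coe.1 (le_of_eq_of_le ?_ (sum_sq_apply_single_le hg))
  rw [NNReal.coe_sum]
  exact Finset.sum_congr rfl fun e _ => mul_one (g (Pi.single e 1) ^ 2)

lemma measure_abs_linearMap_ge_le {g : (ι → ℝ) →ₗ[ℝ] ℝ} {V : ℝ≥0}
    (hg : ∀ x, g x ^ 2 ≤ V * ∑ e, x e ^ 2) {s : ℝ} (hs : 0 ≤ s) :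
    stdGauss ι {x | s ≤ |g x|} ≤ ENNReal.ofReal (2 * Real.exp (-s ^ 2 / (2 * V))) := by
  have hsub := hasSubgaussianMGF_linearMap_stdGauss hg
  rw [← ofReal_measureReal]
  refine ENNReal.ofReal_le_ofReal ?_
  have hunion : {x | s ≤ |g x|} = {x | s ≤ g x} ∪ {x | s ≤ (-g) x} := by
    ext x
    exact le_abs (a := s) (b := g x)
  rw [hunion, two_mul]
  exact (measureReal_union_le _ _).trans
    (add_le_add (hsub.measure_ge_le hs) (hsub.neg.measure_ge_le hs))

section NormedSpace

variable {E F : Type*} [NormedAddCommGroup E] [NormedSpace ℝ E] [FiniteDimensional ℝ E]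
  [NormedAddCommGroup F] [NormedSpace ℝ F] [FiniteDimensional ℝ F]

lemma measure_norm_linearMap_ge_le {L : (ι → ℝ) →ₗ[ℝ] F} {V : ℝ≥0}
    (hL : ∀ x, ‖L x‖ ^ 2 ≤ V * ∑ e, x e ^ 2) {t : ℝ} (ht : 0 < t) :
    stdGauss ι {x | t ≤ ‖L x‖} ≤ 5 ^ Module.finrank ℝ F *
      ENNReal.ofReal (2 * Real.exp (-2 * t ^ 2 / (25 * V))) := by
  have hdual : Module.finrank ℝ (StrongDual ℝ F) = Module.finrank ℝ F := by
    rw [← LinearMap.toContinuousLinearMap.finrank_eq]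
    exact Subspace.dual_finrank_eq
  have hnorm (x : ι → ℝ) : ‖L x‖ = ‖NormedSpace.inclusionInDoubleDualLi ℝ (L x)‖ :=
    (LinearIsometry.norm_map _ _).symm
  simp only [hnorm, ← hdual]
  refine measure_opNorm_ge_le (E := StrongDual ℝ F) ?_ ht fun u hu => ?_
  · have hcont : Continuous L := L.continuous_of_finiteDimensional
    have happly : Continuous fun z : (ι → ℝ) × StrongDual ℝ F => z.2 (L z.1) := by fun_prop
    exact happly.norm.measurable
  · have hg (x : ι → ℝ) :
        ((u : F →ₗ[ℝ] ℝ) ∘ₗ L) x ^ 2 ≤ (25 / 16 * V : ℝ≥0) * ∑ e, x e ^ 2 := by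
      calc u (L x) ^ 2 = ‖u (L x)‖ ^ 2 := (sq_abs _).symm
        _ ≤ (5 / 4 * ‖L x‖) ^ 2 := by gcongr; exact u.le_of_opNorm_le hu _
        _ = 25 / 16 * ‖L x‖ ^ 2 := by ring
        _ ≤ 25 / 16 * (V * ∑ e, x e ^ 2) := by gcongr; exact hL x
        _ = _ := by push_cast; ring
    refine (measure_abs_linearMap_ge_le hg (half_pos ht).le).trans_eq ?_
    congr 3
    push_cast
    ring

lemma measure_opNorm_linearMap_ge_le {L : (ι → ℝ) →ₗ[ℝ] E →L[ℝ] F} {V : ℝ≥0}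
    (hL : ∀ x u, ‖L x u‖ ^ 2 ≤ V * ‖u‖ ^ 2 * ∑ e, x e ^ 2) {κ : ℝ} (hκ : 0 < κ) :
    stdGauss ι {x | κ ≤ ‖L x‖} ≤ 5 ^ (Module.finrank ℝ E + Module.finrank ℝ F) *
      ENNReal.ofReal (2 * Real.exp (-8 * κ ^ 2 / (625 * V))) := by
  borelize E
  rw [pow_add, mul_assoc]
  refine measure_opNorm_ge_le ?_ hκ fun u hu => ?_
  · have hcont : Continuous L := L.continuous_of_finiteDimensional
    have happly : Continuous fun z : (ι → ℝ) × E => L z.1 z.2 := by fun_prop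
    exact happly.norm.measurable
  · have hLu (x : ι → ℝ) :
        ‖(ContinuousLinearMap.coeLM ℝ ∘ₗ L).flip u x‖ ^ 2 ≤
          (25 / 16 * V : ℝ≥0) * ∑ e, x e ^ 2 := by
      calc ‖L x u‖ ^ 2 ≤ V * ‖u‖ ^ 2 * ∑ e, x e ^ 2 := hL x u
        _ ≤ V * (5 / 4) ^ 2 * ∑ e, x e ^ 2 := by gcongr
        _ = _ := by push_cast; ring
    refine (measure_norm_linearMap_ge_le hLu (half_pos hκ)).trans_eq ?_
    congr 4
    push_cast
    ring

end NormedSpace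

end StdGauss

section SymmetricNoise

variable {I : Type*}

/-- The symmetric matrix whose entries are the coordinates indexed by unordered pairs; under the
standard Gaussian measure it is a symmetric Gaussian random matrix. -/
def symmOf : (Sym2 I → ℝ) →ₗ[ℝ] Matrix I I ℝ where
  toFun x := Matrix.of fun p q => x s(p, q)
  map_add' _ _ := rfl
  map_smul' _ _ := rfl

@[simp]
lemma symmOf_apply (x : Sym2 I → ℝ) (p q : I) : symmOf x p q = x s(p, q) := rfl

lemma isSymm_symmOf (x : Sym2 I → ℝ) : (symmOf x).IsSymm :=
  Matrix.IsSymm.ext fun _ _ => congrArg x Sym2.eq_swap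

lemma continuous_symmOf : Continuous (symmOf : (Sym2 I → ℝ) →ₗ[ℝ] Matrix I I ℝ) :=
  continuous_matrix fun _ _ => continuous_apply _

lemma card_filter_mk_eq_le_two [Fintype I] [DecidableEq I] (z : Sym2 I) :
    Finset.card {e : I × I | s(e.1, e.2) = z} ≤ 2 := by
  induction z with
  | _ p q =>
    refine (Finset.card_le_card (t := {(p, q), (q, p)}) fun e he => ?_).trans Finset.card_le_two
    simpa [Prod.ext_iff] using he

lemma norm_symmOf_sq_le [Fintype I] [DecidableEq I] (x : Sym2 I → ℝ) :
    ‖symmOf x‖ ^ 2 ≤ 2 * ∑ z, x z ^ 2 := by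
  calc ‖symmOf x‖ ^ 2 = ∑ e : I × I, x s(e.1, e.2) ^ 2 := by
        rw [frobenius_norm_sq_eq_sum, Fintype.sum_prod_type]
        rfl
    _ = ∑ z, ∑ e : I × I with s(e.1, e.2) = z, x z ^ 2 :=
        (Finset.sum_fiberwise' Finset.univ (fun e : I × I => s(e.1, e.2)) fun z => x z ^ 2).symm
    _ ≤ ∑ z, 2 * x z ^ 2 := by
        gcongr with z
        rw [Finset.sum_const, nsmul_eq_mul]
        gcongr
        exact_mod_cast card_filter_mk_eq_le_two z
    _ = 2 * ∑ z, x z ^ 2 := (Finset.mul_sum ..).symm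

lemma measure_opNorm_symmOf_ge_le [Fintype I] [DecidableEq I] {κ : ℝ} (hκ : 0 < κ) :
    stdGauss (Sym2 I) {x | κ ≤ opNorm (symmOf x)} ≤ 5 ^ (2 * Fintype.card I) *
      ENNReal.ofReal (2 * Real.exp (-4 * κ ^ 2 / 625)) := by
  have hL (x : Sym2 I → ℝ) (u : EuclideanSpace ℝ I) :
      ‖Matrix.toEuclideanCLM (𝕜 := ℝ) (symmOf x) u‖ ^ 2 ≤
        (2 : NNReal) * ‖u‖ ^ 2 * ∑ z, x z ^ 2 := by
    calc ‖Matrix.toEuclideanCLM (𝕜 := ℝ) (symmOf x) u‖ ^ 2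
        ≤ (‖symmOf x‖ * ‖u‖) ^ 2 := by
          gcongr
          exact ContinuousLinearMap.le_of_opNorm_le _ (opNorm_le_norm _) u
      _ = ‖u‖ ^ 2 * ‖symmOf x‖ ^ 2 := by ring
      _ ≤ ‖u‖ ^ 2 * (2 * ∑ z, x z ^ 2) := by gcongr; exact norm_symmOf_sq_le x
      _ = _ := by push_cast; ring
  have h := measure_opNorm_linearMap_ge_le
    (L := (Matrix.toEuclideanCLM (n := I) (𝕜 := ℝ)).toAlgEquiv.toLinearMap ∘ₗ symmOf) hL hκ
  rw [finrank_euclideanSpace, ← two_mul] at h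
  refine h.trans_eq ?_
  congr 4
  push_cast
  ring

end SymmetricNoise

section CanonicalModel

variable {n d : ℕ}

/-- The position on or above the diagonal, in the lexicographic order, of an unordered pair. -/
def upperIndex (z : Sym2 (Fin n × Fin d)) :
    {e : (Fin n × Fin d) × (Fin n × Fin d) // toLex e.1 ≤ toLex e.2} :=
  ⟨(ofLex (z.map toLex).inf, ofLex (z.map toLex).sup), Sym2.inf_le_sup _⟩

lemma upperIndex_injective : Function.Injective (upperIndex (n := n) (d := d)) := fun _ _ h =>
  Sym2.map.injective toLex.injective <| Sym2.inf_eq_inf_and_sup_eq_sup.1 <|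
    Prod.ext_iff.1 (congrArg Subtype.val h)

lemma apply_upperIndex {N : BigMatrix n d} (hN : N.IsSymm) (p q : Fin n × Fin d) :
    N (upperIndex s(p, q)).1.1 (upperIndex s(p, q)).1.2 = N p q := by
  rcases le_total (toLex p) (toLex q) with h | h
  · simp [upperIndex, h]
  · simp [upperIndex, h, hN.apply p q]

variable {Ω : Type*} [MeasurableSpace Ω] {P : Measure Ω} [IsProbabilityMeasure P]
  {W : Ω → BigMatrix n d}

lemma IsSymmGaussian.map_eq (hW : IsSymmGaussian W P) :
    P.map (fun ω z => W ω (upperIndex z).1.1 (upperIndex z).1.2) =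
      stdGauss (Sym2 (Fin n × Fin d)) := by
  rw [(iIndepFun_iff_map_fun_eq_pi_map fun z => (hW.law _ _).aemeasurable).1
    (hW.indep.precomp upperIndex_injective)]
  exact congrArg Measure.pi (funext fun z => (hW.law _ _).map_eq)

lemma IsSymmGaussian.measure_le (hW : IsSymmGaussian W P) (p : BigMatrix n d → Prop) :
    P {ω | p (W ω)} ≤ stdGauss (Sym2 (Fin n × Fin d)) {x | p (symmOf x)} := by
  have hW' (ω : Ω) : symmOf (fun z => W ω (upperIndex z).1.1 (upperIndex z).1.2) = W ω :=
    Matrix.ext fun p q => apply_upperIndex (hW.symm ω) p q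
  rw [← hW.map_eq]
  refine le_trans (measure_mono fun ω (hω : p (W ω)) => ?_) <|
    Measure.le_map_apply (aemeasurable_pi_lambda _ fun z => (hW.law _ _).aemeasurable) _
  rwa [← hW' ω] at hω

end CanonicalModel

section Independence

lemma indepFun_indicator_stdGauss {ι : Type*} [Fintype ι] (T : Set ι) :
    IndepFun T.indicator Tᶜ.indicator (stdGauss ι) := by
  classical
  have hcoord : iIndepFun (fun e (x : ι → ℝ) => x e) (stdGauss ι) :=
    iIndepFun_pi (X := fun _ (y : ℝ) => y) fun _ => aemeasurable_id
  have hdisj : Disjoint T.toFinset Tᶜ.toFinset := by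
    rw [Set.disjoint_toFinset]
    exact disjoint_compl_right
  have hind := hcoord.indepFun_finset T.toFinset Tᶜ.toFinset hdisj measurable_pi_apply
  have hext (S : Finset ι) : Measurable fun (y : S → ℝ) (e : ι) =>
      if h : e ∈ S then y ⟨e, h⟩ else 0 := by
    refine measurable_pi_lambda _ fun e => ?_
    split_ifs
    · exact measurable_pi_apply _
    · exact measurable_const
  convert hind.comp (hext T.toFinset) (hext Tᶜ.toFinset) using 1 <;>
  · ext x e
    simp [Set.indicator_apply]

lemma measure_joint_le_of_indepFun {Ω α β : Type*} [MeasurableSpace Ω] [MeasurableSpace α]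
    [MeasurableSpace β] {μ : Measure Ω} [IsProbabilityMeasure μ] {X : Ω → α} {Y : Ω → β}
    (hX : Measurable X) (hY : Measurable Y) (hXY : IndepFun X Y μ) {B : Set (α × β)}
    (hB : MeasurableSet B) {ε : ENNReal} (hε : ∀ y, μ {ω | (X ω, y) ∈ B} ≤ ε) :
    μ {ω | (X ω, Y ω) ∈ B} ≤ ε := by
  have := Measure.isProbabilityMeasure_map (μ := μ) hX.aemeasurable
  have := Measure.isProbabilityMeasure_map (μ := μ) hY.aemeasurable
  calc μ {ω | (X ω, Y ω) ∈ B} = μ.map (fun ω => (X ω, Y ω)) B :=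
        (Measure.map_apply (hX.prodMk hY) hB).symm
    _ = ∫⁻ y, μ.map X ((fun x => (x, y)) ⁻¹' B) ∂(μ.map Y) := by
        rw [(indepFun_iff_map_prod_eq_prod_map_map hX.aemeasurable hY.aemeasurable).1 hXY,
          Measure.prod_apply_symm hB]
    _ ≤ ∫⁻ _, ε ∂(μ.map Y) := by
        refine lintegral_mono fun y => ?_
        rw [Measure.map_apply hX (measurable_prodMk_right hB)]
        exact hε y
    _ = ε := by simp

end Independence

section IndependentRow

variable {n d : ℕ}

/-- The unordered pairs of positions that meet the `i`-th block. -/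
def crossing (d : ℕ) (i : Fin n) : Set (Sym2 (Fin n × Fin d)) := {z | ∃ p ∈ z, p.1 = i}

lemma mk_mem_crossing {i : Fin n} {p q : Fin n × Fin d} :
    s(p, q) ∈ crossing d i ↔ p.1 = i ∨ q.1 = i := by
  simp only [crossing, Set.mem_ofPred_eq, Sym2.mem_iff, exists_eq_or_imp, exists_eq_left]

lemma symmOf_indicator_compl_crossing (i : Fin n) (x : Sym2 (Fin n × Fin d) → ℝ) :
    symmOf ((crossing d i)ᶜ.indicator x) = leaveOut i (symmOf x) := by
  classical
  ext p q
  simp only [symmOf_apply, Set.indicator_apply, Set.mem_compl_iff, mk_mem_crossing, leaveOut_apply,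
    ite_not]

lemma rowBlock_symmOf_indicator_crossing_mul (i : Fin n) (x : Sym2 (Fin n × Fin d) → ℝ)
    (S : Stack n d) :
    rowBlock (symmOf ((crossing d i).indicator x) * S) i = rowBlock (symmOf x * S) i := by
  ext a b
  simp [rowBlock, Matrix.mul_apply, mk_mem_crossing]

lemma measure_norm_rowBlock_symmOf_mul_ge_le {S : Stack n d} (hS : Sᵀ * S = (n : ℝ) • 1)
    (i : Fin n) {t : ℝ} (ht : 0 < t) :
    stdGauss (Sym2 (Fin n × Fin d)) {x | t ≤ ‖rowBlock (symmOf x * S) i‖} ≤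
      5 ^ (d * d) * ENNReal.ofReal (2 * Real.exp (-t ^ 2 / (25 * n))) := by
  let L : (Sym2 (Fin n × Fin d) → ℝ) →ₗ[ℝ] Matrix (Fin d) (Fin d) ℝ :=
    { toFun := fun x => rowBlock (symmOf x * S) i
      map_add' := fun x y => by rw [map_add, Matrix.add_mul]; rfl
      map_smul' := fun c x => by rw [map_smul, Matrix.smul_mul]; rfl }
  have hL (x : Sym2 (Fin n × Fin d) → ℝ) : ‖L x‖ ^ 2 ≤ (2 * n : NNReal) * ∑ z, x z ^ 2 := by
    calc ‖L x‖ ^ 2 ≤ ‖symmOf x * S‖ ^ 2 := by gcongr; exact norm_rowBlock_le _ i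
      _ ≤ n * ‖symmOf x‖ ^ 2 := frobenius_norm_sq_mul_le n.cast_nonneg hS _
      _ ≤ n * (2 * ∑ z, x z ^ 2) := by gcongr; exact norm_symmOf_sq_le x
      _ = _ := by push_cast; ring
  refine (measure_norm_linearMap_ge_le hL ht).trans_eq ?_
  rw [Module.finrank_matrix, Fintype.card_fin, Module.finrank_self, mul_one]
  congr 4
  push_cast
  rw [show -2 * t ^ 2 = -t ^ 2 * 2 by ring, show 25 * (2 * (n : ℝ)) = 25 * n * 2 by ring,
    mul_div_mul_right _ _ two_ne_zero]

/- The `i`-th block row of the noise is independent of the matrix with that row and column left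
out, so conditionally on the latter the factor `Φ` is deterministic. -/
lemma measure_norm_rowBlock_leaveOut_ge_le {Φ : BigMatrix n d → Stack n d}
    (hΦ : ∀ N, (Φ N)ᵀ * Φ N = (n : ℝ) • 1)
    (hmeas : ∀ p c, Measurable fun x => Φ (symmOf x) p c) (i : Fin n) {t : ℝ} (ht : 0 < t) :
    stdGauss (Sym2 (Fin n × Fin d))
        {x | t ≤ ‖rowBlock (symmOf x * Φ (leaveOut i (symmOf x))) i‖} ≤
      5 ^ (d * d) * ENNReal.ofReal (2 * Real.exp (-t ^ 2 / (25 * n))) := by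
  have hind (T : Set (Sym2 (Fin n × Fin d))) :
      Measurable (T.indicator : (Sym2 (Fin n × Fin d) → ℝ) → _) := by
    classical
    refine measurable_pi_lambda _ fun z => ?_
    by_cases hz : z ∈ T
    · simpa only [Set.indicator_of_mem hz] using measurable_pi_apply z
    · simpa only [Set.indicator_of_notMem hz] using measurable_const
  have hB : MeasurableSet {z : (Sym2 (Fin n × Fin d) → ℝ) × (Sym2 (Fin n × Fin d) → ℝ) |
      t ≤ ‖rowBlock (symmOf z.1 * Φ (symmOf z.2)) i‖} := by
    refine measurableSet_le measurable_const (measurable_frobenius_norm fun a b => ?_)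
    simp only [rowBlock, Matrix.of_apply, Matrix.mul_apply, symmOf_apply]
    exact Finset.measurable_sum _ fun q _ =>
      ((measurable_pi_apply _).comp measurable_fst).mul ((hmeas q b).comp measurable_snd)
  have h := measure_joint_le_of_indepFun (hind (crossing d i)) (hind (crossing d i)ᶜ)
    (indepFun_indicator_stdGauss (crossing d i)) hB fun y => by
      simp only [Set.mem_ofPred_eq, rowBlock_symmOf_indicator_crossing_mul]
      exact measure_norm_rowBlock_symmOf_mul_ge_le (hΦ _) i ht
  simpa only [Set.mem_ofPred_eq, rowBlock_symmOf_indicator_crossing_mul,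
    symmOf_indicator_compl_crossing] using h

end IndependentRow

section HighProbability

open Real

variable {n d : ℕ}

lemma five_pow_mul_ofReal_exp_le {m : ℕ} {a b : ℝ} (h : a + 2 * m ≤ b) :
    (5 : ENNReal) ^ m * ENNReal.ofReal (2 * exp a) ≤ ENNReal.ofReal (2 * exp b) := by
  have hfive : (5 : ℝ) ≤ exp 2 := by
    rw [show (2 : ℝ) = 1 + 1 by norm_num, exp_add]
    nlinarith [exp_one_gt_d9]
  rw [← ENNReal.ofReal_ofNat, ← ENNReal.ofReal_pow (by norm_num),
    ← ENNReal.ofReal_mul (by positivity)]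
  refine ENNReal.ofReal_le_ofReal ?_
  calc (5 : ℝ) ^ m * (2 * exp a) ≤ exp 2 ^ m * (2 * exp a) := by gcongr
    _ = 2 * exp (a + 2 * m) := by rw [← exp_nat_mul, exp_add]; ring_nf
    _ ≤ 2 * exp b := by gcongr

lemma measure_opNorm_symmOf_ge_sqrt_le (hn : 0 < n) (hd : 0 < d) :
    stdGauss (Sym2 (Fin n × Fin d)) {x | 32 * (√n * √d) ≤ opNorm (symmOf x)} ≤
      ENNReal.ofReal (2 / (n : ℝ) ^ 2) := by
  have hn' : (0 : ℝ) < n := by exact_mod_cast hn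
  have hd' : (1 : ℝ) ≤ d := by exact_mod_cast hd
  have hexp : exp (-(2 * log n)) = 1 / (n : ℝ) ^ 2 := by
    rw [exp_neg, two_mul, exp_add, exp_log hn', one_div, sq]
  refine (measure_opNorm_symmOf_ge_le (by positivity)).trans
    ((five_pow_mul_ofReal_exp_le (b := -(2 * log n)) ?_).trans_eq (by rw [hexp, mul_one_div]))
  rw [mul_pow, mul_pow, sq_sqrt hn'.le, sq_sqrt (by positivity), Fintype.card_prod,
    Fintype.card_fin, Fintype.card_fin]
  push_cast
  nlinarith [log_le_self hn'.le]

lemma measure_norm_rowBlock_leaveOut_ge_sqrt_le (hn : 0 < n) (hd : 0 < d)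
    {Φ : BigMatrix n d → Stack n d} (hΦ : ∀ N, (Φ N)ᵀ * Φ N = (n : ℝ) • 1)
    (hmeas : ∀ p c, Measurable fun x => Φ (symmOf x) p c) (i : Fin n) :
    stdGauss (Sym2 (Fin n × Fin d)) {x | 32 * (√n * √d * (√d + √(log n))) ≤
        ‖rowBlock (symmOf x * Φ (leaveOut i (symmOf x))) i‖} ≤
      ENNReal.ofReal (2 / (n : ℝ) ^ 3) := by
  have hn' : (0 : ℝ) < n := by exact_mod_cast hn
  have hd' : (1 : ℝ) ≤ d := by exact_mod_cast hd
  have hlog : 0 ≤ log n := log_natCast_nonneg n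
  have hsum : d + log n ≤ (√d + √(log n)) ^ 2 := by
    rw [add_sq, sq_sqrt hlog, sq_sqrt (by positivity)]
    linarith [show 0 ≤ 2 * √(d : ℝ) * √(log n) by positivity]
  have hexp : exp (-(3 * log n)) = 1 / (n : ℝ) ^ 3 := by
    rw [exp_neg, ← exp_log (pow_pos hn' 3), log_pow, one_div]
    norm_cast
  refine (measure_norm_rowBlock_leaveOut_ge_le hΦ hmeas i (by positivity)).trans
    ((five_pow_mul_ofReal_exp_le (b := -(3 * log n)) ?_).trans_eq (by rw [hexp, mul_one_div]))
  have hsq : -(32 * (√n * √d * (√d + √(log n)))) ^ 2 / (25 * n)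
      = -(1024 / 25 * (d * (√d + √(log n)) ^ 2)) := by
    rw [mul_pow, mul_pow, mul_pow, sq_sqrt hn'.le, sq_sqrt (by positivity)]
    field_simp
    ring
  rw [hsq]
  push_cast
  nlinarith [mul_le_mul_of_nonneg_left hsum d.cast_nonneg, mul_nonneg (sub_nonneg.2 hd') hlog]

/-- The noise level `σ √(d / n) (√d + √(log n))`, which bounds the blockwise error up to a constant
and which the hypothesis on `σ` makes small. -/
noncomputable def noiseLevel (n d : ℕ) (σ : ℝ) : ℝ := σ * √((d : ℝ) / n) * (√d + √(log n))

lemma noiseLevel_mul (n d : ℕ) (σ : ℝ) :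
    noiseLevel n d σ * n = σ * (√n * √d * (√d + √(log n))) := by
  have hn : (n : ℝ) / √n = √n := div_sqrt
  calc noiseLevel n d σ * n = σ * √d * (n / √n) * (√d + √(log n)) := by
        rw [noiseLevel, sqrt_div d.cast_nonneg]; ring
    _ = _ := by rw [hn]; ring

lemma noiseLevel_lt (hn : 0 < n) (hd : 0 < d) {c σ : ℝ}
    (hσ : σ < c * √n / (√d * (√d + √(log n)))) : noiseLevel n d σ < c := by
  have hn' : (0 : ℝ) < √n := by positivity
  rw [lt_div_iff₀ (by positivity)] at hσ
  refine lt_of_mul_lt_mul_right ?_ n.cast_nonneg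
  calc noiseLevel n d σ * n = √n * (σ * (√d * (√d + √(log n)))) := by
        rw [noiseLevel_mul]; ring
    _ < √n * (c * √n) := by gcongr
    _ = c * n := by rw [mul_left_comm, mul_self_sqrt n.cast_nonneg]

/-- The conclusion for the data `G Gᵀ + N`: the relaxation is tight and every maximum likelihood
estimator has blockwise error at most `b`. -/
def IsTightWithError (G : Fin n → Matrix (Fin d) (Fin d) ℝ) (N : BigMatrix n d) (b : ℝ) : Prop :=
  IsTight (gram G + N) ∧ ∀ R, IsMLE (gram G + N) R → BlockErrorLE R G b

lemma isTightWithError_of_opNorm_lt_of_row_lt {G : Stack n d} (hn : 0 < n)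
    (hG : IsOrth (rowBlock G)) {σ : ℝ} (hσ : 0 ≤ σ) (hlevel : noiseLevel n d σ ≤ 1 / 512)
    {x : Sym2 (Fin n × Fin d) → ℝ} (hop : opNorm (symmOf x) < 32 * (√n * √d))
    (hrow : ∀ i, ‖rowBlock (symmOf x * clippedFixedPoint G (σ • leaveOut i (symmOf x))) i‖ <
      32 * (√n * √d * (√d + √(log n)))) :
    IsTightWithError (rowBlock G) (σ • symmOf x) (96 * noiseLevel n d σ) := by
  have hη : 32 * noiseLevel n d σ * n = σ * (32 * (√n * √d * (√d + √(log n)))) := by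
    rw [mul_assoc, noiseLevel_mul]
    ring
  rw [show 96 * noiseLevel n d σ = 3 * (32 * noiseLevel n d σ) by ring]
  refine isTight_and_blockErrorLE_of_leaveOut hn hG ((isSymm_symmOf x).smul σ) ?_ (by linarith)
    fun i => ?_
  · calc opNorm (σ • symmOf x) * √d = σ * (opNorm (symmOf x) * √d) := by
          rw [opNorm_smul, abs_of_nonneg hσ, mul_assoc]
      _ ≤ σ * (32 * (√n * √d) * (√d + √(log n))) := by
          gcongr
          exact le_add_of_nonneg_right (sqrt_nonneg _)
      _ = 32 * noiseLevel n d σ * n := by rw [hη]; ring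
  · have hleave : leaveOut i (σ • symmOf x) = σ • leaveOut i (symmOf x) := by
      rw [leaveOut, Matrix.mul_smul, Matrix.smul_mul, leaveOut]
    rw [hleave, hη, Matrix.smul_mul]
    calc ‖σ • rowBlock (symmOf x * clippedFixedPoint G (σ • leaveOut i (symmOf x))) i‖
        = σ * ‖rowBlock (symmOf x * clippedFixedPoint G (σ • leaveOut i (symmOf x))) i‖ := by
          rw [norm_smul, norm_of_nonneg hσ]
      _ ≤ _ := mul_le_mul_of_nonneg_left (hrow i).le hσ

lemma measure_not_isTightWithError_le {G : Stack n d} (hn : 0 < n) (hd : 0 < d)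
    (hG : IsOrth (rowBlock G)) {σ : ℝ} (hσ : 0 ≤ σ) (hlevel : noiseLevel n d σ ≤ 1 / 512) :
    stdGauss (Sym2 (Fin n × Fin d))
        {x | ¬ IsTightWithError (rowBlock G) (σ • symmOf x) (96 * noiseLevel n d σ)} ≤
      ENNReal.ofReal (4 / (n : ℝ) ^ 2) := by
  let Φ : BigMatrix n d → Stack n d := fun N => clippedFixedPoint G (σ • N)
  let badRow : Fin n → Set (Sym2 (Fin n × Fin d) → ℝ) := fun i =>
    {x | 32 * (√n * √d * (√d + √(log n))) ≤
      ‖rowBlock (symmOf x * Φ (leaveOut i (symmOf x))) i‖}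
  have hsub : {x | ¬ IsTightWithError (rowBlock G) (σ • symmOf x) (96 * noiseLevel n d σ)} ⊆
      {x | 32 * (√n * √d) ≤ opNorm (symmOf x)} ∪ ⋃ i, badRow i := by
    intro x hx
    by_contra hgood
    rw [Set.mem_union, Set.mem_iUnion, not_or, not_exists] at hgood
    exact hx (isTightWithError_of_opNorm_lt_of_row_lt hn hG hσ hlevel (not_le.1 hgood.1)
      fun i => not_le.1 (hgood.2 i))
  have hrows : stdGauss (Sym2 (Fin n × Fin d)) (⋃ i, badRow i) ≤
      ENNReal.ofReal (2 / (n : ℝ) ^ 2) := by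
    calc stdGauss (Sym2 (Fin n × Fin d)) (⋃ i, badRow i)
        ≤ ∑ i, stdGauss (Sym2 (Fin n × Fin d)) (badRow i) := measure_iUnion_fintype_le _ _
      _ ≤ ∑ _ : Fin n, ENNReal.ofReal (2 / (n : ℝ) ^ 3) := by
          gcongr with i
          exact measure_norm_rowBlock_leaveOut_ge_sqrt_le (Φ := Φ) hn hd
            (fun N => (isOrth_clippedFixedPoint hG _).transpose_mul_self)
            (measurable_clippedFixedPoint_apply hn hG (continuous_symmOf.const_smul σ)) i
      _ = ENNReal.ofReal (2 / (n : ℝ) ^ 2) := by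
          rw [Finset.sum_const, Finset.card_univ, Fintype.card_fin, ← ENNReal.ofReal_nsmul,
            nsmul_eq_mul]
          congr 1
          field_simp
  calc _ ≤ ENNReal.ofReal (2 / (n : ℝ) ^ 2) + ENNReal.ofReal (2 / (n : ℝ) ^ 2) :=
        (measure_mono hsub).trans <| (measure_union_le _ _).trans <|
          add_le_add (measure_opNorm_symmOf_ge_sqrt_le hn hd) hrows
    _ = ENNReal.ofReal (4 / (n : ℝ) ^ 2) := by
        rw [← ENNReal.ofReal_add (by positivity) (by positivity)]
        congr 1
        ring

end HighProbability

end OrthSync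

/-- The probability bound is stated for the outer measure of the exceptional set, so it does not
depend on that set being measurable. -/
theorem theorem1 :
    ∃ c₀ C₀ C₁ : ℝ, 0 < c₀ ∧ 0 < C₀ ∧ 0 < C₁ ∧
      ∀ (n d : ℕ), 1 ≤ n → 1 ≤ d →
      ∀ (G : Fin n → Matrix (Fin d) (Fin d) ℝ), OrthSync.IsOrth G →
      ∀ (σ : ℝ), 0 ≤ σ →
        σ < c₀ * √(n : ℝ) / (√(d : ℝ) * (√(d : ℝ) + √(Real.log n))) →
      ∀ {Ω : Type*} [MeasurableSpace Ω] (P : Measure Ω) [IsProbabilityMeasure P]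
        (W : Ω → OrthSync.BigMatrix n d), OrthSync.IsSymmGaussian W P →
        P {ω | ¬ (OrthSync.IsTight (OrthSync.observation G σ (W ω)) ∧
            ∀ R, OrthSync.IsMLE (OrthSync.observation G σ (W ω)) R →
              OrthSync.BlockErrorLE R G
                (C₀ * (σ * √((d : ℝ) / n) * (√(d : ℝ) + √(Real.log n)))))}
          ≤ ENNReal.ofReal (C₁ / (n : ℝ) ^ 2) := by
  refine ⟨1 / 512, 96, 4, by norm_num, by norm_num, by norm_num, ?_⟩
  intro n d hn hd G hG σ hσ hσlt Ω _ P _ W hW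
  have hlevel : OrthSync.noiseLevel n d σ < 1 / 512 := OrthSync.noiseLevel_lt hn hd hσlt
  exact (hW.measure_le fun N => ¬ OrthSync.IsTightWithError G (σ • N)
    (96 * OrthSync.noiseLevel n d σ)).trans
      (OrthSync.measure_not_isTightWithError_le (G := OrthSync.stack G) hn hd hG hσ hlevel.le)
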